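/- **Setting.** A game has $n\ge 1$ players with $d\ge 2$ actions each, pure-profile payoffs $\mathcal U_i\in[-1,1]$, and multilinear expected utilities $\nu_i(x)$ for mixed profiles $x=(x_1,\dots,x_n)\in(\Delta^d)^n$. For some $L>0$ it is $L$-smooth: $\|\nabla_{x_j}\nu_j(x)-\nabla_{x_j}\nu_j(x')\|_\infty\le L\sum_{i}\|x_i-x_i'\|_1$ for all $j$ and all mixed profiles $x,x'$. A player who plays $x^1,x^2,\dots\in\Delta^d$ and observes utility vectors $\nu^1,\nu^2,\dots\in\mathbb R^d$ has regret $\mathrm{Reg}^T=\max_{x^*\in\Delta^d}\sum_{t\le T}\langle \nu^t,x^*\rangle-\sum_{t\le T}\langle\nu^t,x^t\rangle$. In self-play, player $i$ observes $\nu_i^t=\nabla_{x_i}\nu_i(x^t)$. **DLRC-OMWU** with parameters $\eta,\alpha,\beta$: put $u^0=U^1=0$. In round $t$ let $r^t=U^t+u^{t-1}$; let $\lambda^t=\eta$ if $\max_k r^t[k]\ge-\beta\log^2 d$, and otherwise $\lambda^t=\arg\max_{\lambda\in(0,\eta]}\{\log\sum_k e^{\lambda r^t[k]}+(\alpha-1)\log\lambda\}$.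 Play $x^t[k]=e^{\lambda^t r^t[k]}/\sum_{k'}e^{\lambda^t r^t[k']}$, observe $\nu^t$, and set $u^t=\nu^t-\langle\nu^t,x^t\rangle\mathbf 1$ and $U^{t+1}=U^t+u^t$. Throughout, $\eta=\min\{\frac1{50},\frac1{12\sqrt2Ln}\}$, $\alpha=2+2\log d+\beta\log^2d$ and $\beta\ge70$. **Safeguarded variant:** play DLRC-OMWU; as soon as after some round $t$ $$\sum_{\tau=1}^{t-1}\|\nu^{\tau+1}-\nu^\tau\|_\infty^2>144L^2n^2\eta+48L^2n^2(\alpha\log t+\log d),$$ play from round $t+1$ on a freshly started MWU, which in its $s$-th round plays action $k$ with probability proportional to $\exp(\sqrt{\log d/s}\;R[k])$, where $R$ is the sum of the utility vectors observed since the switch. **Theorem.** Let $B(T)=6+\max\{50+12\sqrt2Ln,\,24\sqrt2Ln\}(\alpha\log T+\log d)$. There is an absolute constant $C$ such that, for all $n\ge1$, $d\ge2$, $L>0$ and $\beta\ge70$, the following hold. 1. In every game as above in which all $n$ players run DLRC-OMWU, every player $i$ has $\mathrm{Reg}_i^T\le B(T)$ for every $T\ge1$ simultaneously, and $\mathrm{Reg}_i^T\le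 C\beta(1+L)\,n\log^2d\,\log T$ for every $T\ge2$; that is, $\mathrm{Reg}_i^T=O(n\log^2d\log T)$. 2. If instead all players run the safeguarded variant, they play exactly the same strategies as under DLRC-OMWU, so the same bounds hold. 3. Against every sequence of utility vectors in $[-1,1]^d$, the safeguarded variant has $\mathrm{Reg}^T\le B(T)+C\sqrt{T\log d}$ for every $T\ge1$ simultaneously, and $\mathrm{Reg}^T\le C\sqrt{\beta(1+Ln)}\,\sqrt{\log d\,\log T}\,\sqrt{T\log d}$ for every $T\ge2$; that is, $\mathrm{Reg}^T=\tilde O(\sqrt{T\log d})$. -/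

import Mathlib

open scoped BigOperators

namespace DLRC

/-- A normal-form game with `n` players, each having the `d` actions `Fin d`:
`utility i s` is the payoff of player `i` under the pure action profile `s`. -/
structure Game (n d : ℕ) where
  utility : Fin n → (Fin n → Fin d) → ℝ

namespace Game

variable {n d : ℕ}

/-- Multilinear extension: the expected utility of player `i` when the players draw their actions
independently from the mixed strategies `x 0, …, x (n - 1)`. -/
def expectedUtility (G : Game n d) (i : Fin n) (x : Fin n → Fin d → ℝ) : ℝ :=
  ∑ s : Fin n → Fin d, (∏ j, x j (s j)) * G.utility i s

/-- The gradient of the expected utility of player `i` in that player's own strategy. By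
multilinearity its `k`-th coordinate is the expected utility of player `i` when `x i` is replaced
by the pure action `k` (see `hasDerivAt_expectedUtility`). -/
def utilityVector (G : Game n d) (i : Fin n) (x : Fin n → Fin d → ℝ) : Fin d → ℝ :=
  fun k => G.expectedUtility i (Function.update x i (Pi.single k 1))

/-- All payoffs lie in `[-1, 1]`. -/
def Bounded (G : Game n d) : Prop :=
  ∀ (j : Fin n) (s : Fin n → Fin d), |G.utility j s| ≤ 1

/-- `L`-smoothness: on mixed profiles, the utility vectors are `L`-Lipschitz from the sum of the
`ℓ¹` distances of the strategies to the sup norm (which is the norm of `Fin d → ℝ`). -/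
def Smooth (G : Game n d) (L : ℝ) : Prop :=
  ∀ (j : Fin n) (x x' : Fin n → Fin d → ℝ),
    (∀ i, x i ∈ stdSimplex ℝ (Fin d)) → (∀ i, x' i ∈ stdSimplex ℝ (Fin d)) →
      ‖G.utilityVector j x - G.utilityVector j x'‖ ≤ L * ∑ i, ∑ k, |x i k - x' i k|

theorem expectedUtility_update_eq (G : Game n d) (i : Fin n) (x : Fin n → Fin d → ℝ)
    (y : Fin d → ℝ) :
    G.expectedUtility i (Function.update x i y) = ∑ k, y k * G.utilityVector i x k := by
  have key : ∀ (z : Fin d → ℝ) (s : Fin n → Fin d),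
      (∏ j, Function.update x i z j (s j)) = z (s i) * ∏ j ∈ Finset.univ.erase i, x j (s j) := by
    intro z s
    rw [← Finset.mul_prod_erase Finset.univ _ (Finset.mem_univ i)]
    congr 1
    · simp
    · refine Finset.prod_congr rfl fun j hj => ?_
      rw [Function.update_of_ne (Finset.ne_of_mem_erase hj)]
  simp only [utilityVector, expectedUtility, key, Finset.mul_sum]
  rw [Finset.sum_comm]
  refine Finset.sum_congr rfl fun s _ => ?_
  rw [Finset.sum_eq_single (s i)]
  · simp [mul_assoc]
  · intro k _ hk
    simp [Ne.symm hk]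
  · simp

/-- `utilityVector` is the vector of partial derivatives in the player's own strategy. -/
theorem hasDerivAt_expectedUtility (G : Game n d) (i : Fin n) (x : Fin n → Fin d → ℝ)
    (k : Fin d) :
    HasDerivAt (fun a : ℝ => G.expectedUtility i (Function.update x i (Function.update (x i) k a)))
      (G.utilityVector i x k) (x i k) := by
  have h : (fun a : ℝ => G.expectedUtility i (Function.update x i (Function.update (x i) k a)))
      = fun a : ℝ => a * G.utilityVector i x k
        + ∑ l ∈ Finset.univ.erase k, x i l * G.utilityVector i x l := by
    funext a
    rw [expectedUtility_update_eq, ← Finset.add_sum_erase Finset.univ _ (Finset.mem_univ k)]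
    congr 1
    · simp
    · refine Finset.sum_congr rfl fun l hl => ?_
      rw [Function.update_of_ne (Finset.ne_of_mem_erase hl)]
  rw [h]
  simpa using ((hasDerivAt_id (x i k)).mul_const (G.utilityVector i x k)).add_const
    (∑ l ∈ Finset.univ.erase k, x i l * G.utilityVector i x l)

end Game

/-- External regret after `T` rounds of the plays `x` against the utilities `ν`: the value of the
best fixed mixed strategy in hindsight minus the value collected. Rounds are indexed from `0`, so
that the rounds `1, …, T` are the indices `0, …, T - 1`. -/
noncomputable def regret {d : ℕ} (ν x : ℕ → Fin d → ℝ) (T : ℕ) : ℝ :=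
  (⨆ y : stdSimplex ℝ (Fin d), ∑ t ∈ Finset.range T, ν t ⬝ᵥ (y : Fin d → ℝ))
    - ∑ t ∈ Finset.range T, ν t ⬝ᵥ x t

/-- A deterministic full-information online learning algorithm with `d` actions: in every round it
plays `play s`, observes a utility vector `v`, and moves from the state `s` to `observe s v`. -/
structure OnlineAlgorithm (d : ℕ) where
  State : Type
  init : State
  play : State → (Fin d → ℝ)
  observe : State → (Fin d → ℝ) → State

namespace OnlineAlgorithm

variable {n d : ℕ}

/-- The state after `t` rounds against the utility sequence `ν`. -/
def stateAgainst (A : OnlineAlgorithm d) (ν : ℕ → Fin d → ℝ) : ℕ → A.State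
  | 0 => A.init
  | t + 1 => A.observe (A.stateAgainst ν t) (ν t)

/-- The strategies played against the utility sequence `ν`. The strategy at index `t` depends on
`ν 0, …, ν (t - 1)` only. -/
def playAgainst (A : OnlineAlgorithm d) (ν : ℕ → Fin d → ℝ) (t : ℕ) : Fin d → ℝ :=
  A.play (A.stateAgainst ν t)

/-- The states of the `n` players after `t` rounds of self-play: every player runs its own copy
of `A` and observes its own utility vector only. -/
def selfPlayState (A : OnlineAlgorithm d) (G : Game n d) : ℕ → Fin n → A.State
  | 0 => fun _ => A.init
  | t + 1 => fun i => A.observe (A.selfPlayState G t i)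
      (G.utilityVector i fun j => A.play (A.selfPlayState G t j))

/-- The mixed strategy profile at index `t` of self-play. -/
def selfPlay (A : OnlineAlgorithm d) (G : Game n d) (t : ℕ) : Fin n → Fin d → ℝ :=
  fun i => A.play (A.selfPlayState G t i)

/-- The regret of player `i` after `T` rounds of self-play. -/
noncomputable def selfPlayRegret (A : OnlineAlgorithm d) (G : Game n d) (i : Fin n) (T : ℕ) : ℝ :=
  regret (fun t => G.utilityVector i (A.selfPlay G t)) (fun t => A.selfPlay G t i) T

/-- The regret after `T` rounds against the utility sequence `ν`. -/
noncomputable def regretAgainst (A : OnlineAlgorithm d) (ν : ℕ → Fin d → ℝ) (T : ℕ) : ℝ :=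
  regret ν (A.playAgainst ν) T

end OnlineAlgorithm

/-- The distribution proportional to `exp (lam * r k)`. -/
noncomputable def softmax {d : ℕ} (lam : ℝ) (r : Fin d → ℝ) : Fin d → ℝ :=
  fun k => Real.exp (lam * r k) / ∑ k', Real.exp (lam * r k')

/-- The objective of the learning rate control problem. -/
noncomputable def rateObjective {d : ℕ} (α : ℝ) (r : Fin d → ℝ) (lam : ℝ) : ℝ :=
  Real.log (∑ k, Real.exp (lam * r k)) + (α - 1) * Real.log lam

open Classical in
/-- The dynamic learning rate: `η` if the largest entry of `r` is at least `-β log² d`, and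
otherwise the maximizer of the rate objective over `(0, η]`. -/
noncomputable def learningRate {d : ℕ} (η α β : ℝ) (r : Fin d → ℝ) : ℝ :=
  if -(β * Real.log d ^ 2) ≤ ⨆ k, r k then η
  else Classical.epsilon fun lam : ℝ =>
    lam ∈ Set.Ioc 0 η ∧ IsMaxOn (rateObjective α r) (Set.Ioc 0 η) lam

/-- The memory of DLRC-OMWU: `cumulative` is the sum of all corrected utility vectors so far and
`last` is the latest one. -/
structure DLRCState (d : ℕ) where
  cumulative : Fin d → ℝ
  last : Fin d → ℝ

/-- DLRC-OMWU: optimistic multiplicative weights update with dynamic learning rate control. -/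
noncomputable def dlrcOMWU (d : ℕ) (η α β : ℝ) : OnlineAlgorithm d where
  State := DLRCState d
  init := ⟨0, 0⟩
  play s := softmax (learningRate η α β (s.cumulative + s.last)) (s.cumulative + s.last)
  observe s v :=
    let r := s.cumulative + s.last
    let x := softmax (learningRate η α β r) r
    let u : Fin d → ℝ := fun k => v k - v ⬝ᵥ x
    ⟨s.cumulative + u, u⟩

/-- The memory of MWU: the cumulative utility vector and the number of rounds so far. -/
structure MWUState (d : ℕ) where
  cumulative : Fin d → ℝ
  rounds : ℕ

/-- Anytime MWU (exponentially weighted forecaster), with learning rate `√(log d / s)` in its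
`s`-th round, `s = 1, 2, …`. -/
noncomputable def mwu (d : ℕ) : OnlineAlgorithm d where
  State := MWUState d
  init := ⟨0, 0⟩
  play s := softmax (Real.sqrt (Real.log d / (s.rounds + 1))) s.cumulative
  observe s v := ⟨s.cumulative + v, s.rounds + 1⟩

/-- The cap `η = min {1/50, 1/(12√2 L n)}` on the learning rate. -/
noncomputable def etaOf (n : ℕ) (L : ℝ) : ℝ :=
  min (1 / 50) (1 / (12 * Real.sqrt 2 * L * n))

/-- `α = 2 + 2 log d + β log² d`. -/
noncomputable def alphaOf (d : ℕ) (β : ℝ) : ℝ :=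
  2 + 2 * Real.log d + β * Real.log d ^ 2

/-- The largest utility variation that the check made after round `t` accepts. -/
noncomputable def checkThreshold (n d : ℕ) (L β : ℝ) (t : ℕ) : ℝ :=
  144 * L ^ 2 * n ^ 2 * etaOf n L
    + 48 * L ^ 2 * n ^ 2 * (alphaOf d β * Real.log t + Real.log d)

/-- The memory of the safeguarded algorithm before it switches: the memory of DLRC-OMWU, the number
of rounds so far, the latest utility vector (meaningless before the first round), and the sum of the
squared sup-norm distances of consecutive utility vectors so far. -/
structure MonitorState (d : ℕ) where
  base : DLRCState d
  rounds : ℕ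
  lastUtility : Fin d → ℝ
  variation : ℝ

open Classical in
/-- DLRC-OMWU with the safeguard against adversarial utilities: it plays DLRC-OMWU, and as soon as
after some round `t` the variation `∑_{τ = 1}^{t - 1} ‖ν^(τ + 1) - ν^τ‖²` exceeds the threshold, it
plays a fresh copy of MWU from round `t + 1` on. -/
noncomputable def safeguarded (n d : ℕ) (L β : ℝ) : OnlineAlgorithm d where
  State := MonitorState d ⊕ MWUState d
  init := Sum.inl ⟨(dlrcOMWU d (etaOf n L) (alphaOf d β) β).init, 0, 0, 0⟩
  play
    | Sum.inl s => (dlrcOMWU d (etaOf n L) (alphaOf d β) β).play s.base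
    | Sum.inr m => (mwu d).play m
  observe
    | Sum.inl s, v =>
        let variation' : ℝ :=
          if s.rounds = 0 then 0 else s.variation + ‖v - s.lastUtility‖ ^ 2
        if checkThreshold n d L β (s.rounds + 1) < variation' then Sum.inr (mwu d).init
        else Sum.inl ⟨(dlrcOMWU d (etaOf n L) (alphaOf d β) β).observe s.base v,
          s.rounds + 1, v, variation'⟩
    | Sum.inr m, v => Sum.inr ((mwu d).observe m v)

/-- The explicit self-play regret bound. -/
noncomputable def regretBound (n d : ℕ) (L β : ℝ) (T : ℕ) : ℝ :=
  6 + max (50 + 12 * Real.sqrt 2 * L * n) (24 * Real.sqrt 2 * L * n)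
    * (alphaOf d β * Real.log T + Real.log d)

end DLRC

/-! DLRC-OMWU is optimistic follow-the-regularized-leader on lifted points `lam • x`: given `R`, it
maximizes `lam * ⟨R, x⟩` plus the entropy of `x` plus `(α - 1) * log lam`. Maximizing over `x` first
leaves `rateObjective`, whose value at the best rate is `potential R`. The objective is not
obviously concave in the rate, since `lse` is convex there. But its second derivative is the
variance of `R` under the softmax, at most `(1 + log² d) / lam²` (`sum_softmax_sq_sub_sq_le`), so
the logarithmic term dominates with surplus `curvature d α`. Hence the optimal rate moves by a
bounded factor when `R` moves by a bounded amount (`IsRate.stable`), and the potential is strongly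
smooth and strongly convex in terms of the `ℓ¹` movement of `x` (`IsRate.potential_le`,
`IsRate.le_potential`).

Telescoping the potential gives `rvu_bound`: regret is at most `(α log T + log d) / η` plus a
multiple of the utility variation, minus a multiple of the squared movement of the strategies. The
point of rate control is that this same right-hand side is nonnegative even when the regret is
negative, because a competitor may shrink its rate to `η / T` at a cost of order `α log T`.

In self-play, adding these nonnegative right-hand sides over all players bounds the total squared
movement: smoothness turns movement into variation, and `η` is small enough for half of the negative
term to absorb it. So each player's variation stays below `checkThreshold` (`dlrc_variation_le`),
which bounds each regret separately and shows that the safeguard never fires. Against arbitrary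
utilities, the variation before a switch is below the threshold up to one round's overshoot, so the
same RVU bound applies there; anytime MWU covers the remaining rounds. -/

namespace DLRC

open Finset

/-! ### Entropy, the log-partition function and the variance bound. -/

section Softmax

variable {d : ℕ}

/-- The normalizing constant of `softmax`. -/
noncomputable def partitionFn (R : Fin d → ℝ) (lam : ℝ) : ℝ := ∑ k, Real.exp (lam * R k)

/-- The log-partition function. -/
noncomputable def lse (R : Fin d → ℝ) (lam : ℝ) : ℝ := Real.log (partitionFn R lam)

/-- The relative entropy of `p` with respect to `q`. -/
noncomputable def relEntropy (p q : Fin d → ℝ) : ℝ := ∑ k, p k * Real.log (p k / q k)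

/-- The `ℓ¹` distance. -/
def dist1 (p q : Fin d → ℝ) : ℝ := ∑ k, |p k - q k|

theorem dist1_nonneg (p q : Fin d → ℝ) : 0 ≤ dist1 p q :=
  sum_nonneg fun _ _ => abs_nonneg _

theorem dist1_triangle (p q r : Fin d → ℝ) : dist1 p r ≤ dist1 p q + dist1 q r := by
  unfold dist1
  rw [← sum_add_distrib]
  exact sum_le_sum fun k _ => abs_sub_le _ _ _

theorem dist1_comm (p q : Fin d → ℝ) : dist1 p q = dist1 q p :=
  sum_congr rfl fun _ _ => abs_sub_comm _ _

theorem abs_sum_mul_sub_le {p q v : Fin d → ℝ} {N : ℝ} (hv : ∀ k, |v k| ≤ N) :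
    |∑ k, v k * (p k - q k)| ≤ N * dist1 p q := by
  unfold dist1
  rw [mul_sum]
  refine (abs_sum_le_sum_abs _ _).trans (sum_le_sum fun k _ => ?_)
  rw [abs_mul]
  exact mul_le_mul_of_nonneg_right (hv k) (abs_nonneg _)

theorem abs_dotProduct_le {p v : Fin d → ℝ} {N : ℝ} (hp : p ∈ stdSimplex ℝ (Fin d))
    (hv : ∀ k, |v k| ≤ N) : |v ⬝ᵥ p| ≤ N := by
  unfold dotProduct
  calc |∑ k, v k * p k| ≤ ∑ k, |v k * p k| := abs_sum_le_sum_abs _ _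
    _ ≤ ∑ k, N * p k := sum_le_sum fun k _ => by
        rw [abs_mul, abs_of_nonneg (hp.1 k)]
        exact mul_le_mul_of_nonneg_right (hv k) (hp.1 k)
    _ = N := by rw [← mul_sum, hp.2, mul_one]

theorem softmax_eq (lam : ℝ) (R : Fin d → ℝ) (k : Fin d) :
    softmax lam R k = Real.exp (lam * R k) / partitionFn R lam := rfl

variable [NeZero d]

theorem partitionFn_pos (R : Fin d → ℝ) (lam : ℝ) : 0 < partitionFn R lam :=
  sum_pos (fun _ _ => Real.exp_pos _) univ_nonempty

theorem softmax_pos (lam : ℝ) (R : Fin d → ℝ) (k : Fin d) : 0 < softmax lam R k :=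
  div_pos (Real.exp_pos _) (partitionFn_pos R lam)

theorem sum_softmax (lam : ℝ) (R : Fin d → ℝ) : ∑ k, softmax lam R k = 1 := by
  simp only [softmax_eq]
  rw [← sum_div]
  exact div_self (partitionFn_pos R lam).ne'

theorem softmax_mem (lam : ℝ) (R : Fin d → ℝ) : softmax lam R ∈ stdSimplex ℝ (Fin d) :=
  ⟨fun k => (softmax_pos lam R k).le, sum_softmax lam R⟩

theorem log_softmax (lam : ℝ) (R : Fin d → ℝ) (k : Fin d) :
    Real.log (softmax lam R k) = lam * R k - lse R lam := by
  rw [softmax_eq, Real.log_div (Real.exp_pos _).ne' (partitionFn_pos R lam).ne', Real.log_exp, lse]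

theorem mul_le_lse (R : Fin d → ℝ) (lam : ℝ) (k : Fin d) : lam * R k ≤ lse R lam := by
  rw [lse, Real.le_log_iff_exp_le (partitionFn_pos R lam)]
  exact single_le_sum (f := fun k => Real.exp (lam * R k)) (fun _ _ => (Real.exp_pos _).le)
    (mem_univ k)

omit [NeZero d] in
theorem lse_zero_left (lam : ℝ) : lse (0 : Fin d → ℝ) lam = Real.log d := by
  simp [lse, partitionFn]

theorem relEntropy_softmax (p : Fin d → ℝ) (hp : ∀ k, 0 < p k) (hs : ∑ k, p k = 1) (lam : ℝ)
    (R : Fin d → ℝ) :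
    relEntropy p (softmax lam R) = ∑ k, p k * Real.log (p k) - lam * (R ⬝ᵥ p) + lse R lam := by
  have h : ∀ k, p k * Real.log (p k / softmax lam R k)
      = p k * Real.log (p k) - lam * (R k * p k) + p k * lse R lam := fun k => by
    rw [Real.log_div (hp k).ne' (softmax_pos lam R k).ne', log_softmax]
    ring
  simp only [relEntropy, h, sum_add_distrib, sum_sub_distrib, ← mul_sum, ← sum_mul, hs, one_mul,
    dotProduct]

theorem sum_softmax_mul_log (lam : ℝ) (R : Fin d → ℝ) :
    ∑ k, softmax lam R k * Real.log (softmax lam R k)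
      = lam * (R ⬝ᵥ softmax lam R) - lse R lam := by
  have h : ∀ k, softmax lam R k * Real.log (softmax lam R k)
      = lam * (R k * softmax lam R k) - softmax lam R k * lse R lam := fun k => by
    rw [log_softmax]
    ring
  simp only [h, sum_sub_distrib, ← mul_sum, ← sum_mul, sum_softmax, one_mul, dotProduct]

omit [NeZero d] in
-- Pinsker with a weaker constant, through the Hellinger distance: relative entropy dominates `∑ (√p
-- - √q)² = 2 - 2 * S`, and Cauchy–Schwarz bounds the squared `ℓ¹` distance by `(2 - 2 * S) * (2 + 2
-- * S)`.
theorem sq_dist1_le_relEntropy (p q : Fin d → ℝ) (hp : ∀ k, 0 < p k) (hq : ∀ k, 0 < q k)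
    (hps : ∑ k, p k = 1) (hqs : ∑ k, q k = 1) : dist1 p q ^ 2 ≤ 4 * relEntropy p q := by
  set S := ∑ k, √(p k) * √(q k) with hS
  have sqp : ∀ k, √(p k) ^ 2 = p k := fun k => Real.sq_sqrt (hp k).le
  have sqq : ∀ k, √(q k) ^ 2 = q k := fun k => Real.sq_sqrt (hq k).le
  have hH : ∑ k, |√(p k) - √(q k)| ^ 2 = 2 - 2 * S := by
    have : ∀ k, |√(p k) - √(q k)| ^ 2 = p k + q k - 2 * (√(p k) * √(q k)) := fun k => by
      rw [sq_abs]
      linear_combination sqp k + sqq k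
    simp only [this, sum_sub_distrib, sum_add_distrib, ← mul_sum, hps, hqs, ← hS]
    norm_num
  have hH' : ∑ k, (√(p k) + √(q k)) ^ 2 = 2 + 2 * S := by
    have : ∀ k, (√(p k) + √(q k)) ^ 2 = p k + q k + 2 * (√(p k) * √(q k)) := fun k => by
      linear_combination sqp k + sqq k
    simp only [this, sum_add_distrib, ← mul_sum, hps, hqs, ← hS]
    norm_num
  have hS0 : 0 ≤ 2 - 2 * S := hH ▸ sum_nonneg fun _ _ => sq_nonneg _
  have hkl : 2 - 2 * S ≤ relEntropy p q := by
    have : ∀ k, 2 * p k - 2 * (√(p k) * √(q k)) ≤ p k * Real.log (p k / q k) := fun k => by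
      have hpk := Real.sqrt_pos.2 (hp k)
      have hqk := Real.sqrt_pos.2 (hq k)
      have h1 : Real.log (p k / q k) = - (2 * Real.log (√(q k) / √(p k))) := by
        rw [Real.log_div (hp k).ne' (hq k).ne', Real.log_div hqk.ne' hpk.ne',
          Real.log_sqrt (hp k).le, Real.log_sqrt (hq k).le]
        ring
      have h2 := Real.log_le_sub_one_of_pos (div_pos hqk hpk)
      have h3 : p k * (√(q k) / √(p k)) = √(p k) * √(q k) := by
        nth_rewrite 1 [← sqp k]
        field_simp
      have h4 := mul_le_mul_of_nonneg_left h2 (hp k).le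
      rw [mul_sub, h3, mul_one] at h4
      rw [h1]
      linarith
    have := sum_le_sum fun k (_ : k ∈ (univ : Finset (Fin d))) => this k
    rw [sum_sub_distrib, ← mul_sum, ← mul_sum, hps, ← hS] at this
    have h' : 2 - 2 * S ≤ ∑ k, p k * Real.log (p k / q k) := by linarith
    exact h'
  have hcs := sum_mul_sq_le_sq_mul_sq univ (fun k => |√(p k) - √(q k)|)
    (fun k => √(p k) + √(q k))
  rw [hH, hH'] at hcs
  have hd : dist1 p q = ∑ k, |√(p k) - √(q k)| * (√(p k) + √(q k)) := by
    refine sum_congr rfl fun k _ => ?_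
    rw [← abs_of_nonneg (add_nonneg (Real.sqrt_nonneg (p k)) (Real.sqrt_nonneg (q k))), ← abs_mul]
    congr 1
    linear_combination -sqp k + sqq k
  rw [hd]
  nlinarith

omit [NeZero d] in
theorem relEntropy_nonneg (p q : Fin d → ℝ) (hp : ∀ k, 0 < p k) (hq : ∀ k, 0 < q k)
    (hps : ∑ k, p k = 1) (hqs : ∑ k, q k = 1) : 0 ≤ relEntropy p q := by
  nlinarith [sq_dist1_le_relEntropy p q hp hq hps hqs, sq_nonneg (dist1 p q)]

theorem mul_log_sq_le_one {x : ℝ} (h0 : 0 < x) (h1 : x ≤ 1) : x * Real.log x ^ 2 ≤ 1 := by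
  have hl : Real.log x = 2 * Real.log √x := by rw [Real.log_sqrt h0.le]; ring
  have hs := Real.sqrt_pos.2 h0
  have hs1 : √x ≤ 1 := Real.sqrt_le_one.2 h1
  have hq := Real.one_sub_inv_le_log_of_pos (Real.sqrt_pos.2 hs)
  have hqs := Real.sqrt_pos.2 hs
  have hl' : Real.log √x = 2 * Real.log √√x := by rw [Real.log_sqrt hs.le]; ring
  set y := √√x with hy
  have hy2 : √x = y ^ 2 := (Real.sq_sqrt hs.le).symm
  have hx : x = y ^ 4 := by rw [← Real.sq_sqrt h0.le, hy2]; ring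
  have hlx : Real.log x = 4 * Real.log y := by linarith
  have hy1 : y ≤ 1 := Real.sqrt_le_one.2 hs1
  have hylog : Real.log y ≤ 0 := Real.log_nonpos hqs.le hy1
  have h5 : y - 1 ≤ y * Real.log y := by
    have := mul_le_mul_of_nonneg_left hq hqs.le
    rwa [mul_sub, mul_one, mul_inv_cancel₀ hqs.ne'] at this
  -- With `x = y ^ 4`, the claim is the square of `-1 ≤ 4 * y² * log y ≤ 0`.
  have h6 : -(1 : ℝ) ≤ 4 * (y ^ 2 * Real.log y) := by
    have := mul_le_mul_of_nonneg_left h5 hqs.le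
    nlinarith [sq_nonneg (2 * y - 1)]
  have h7 : 4 * (y ^ 2 * Real.log y) ≤ 0 := by nlinarith [sq_nonneg y]
  rw [hlx, hx]
  nlinarith

/-- The variance of the log-likelihood of a distribution on `d` points is at most `1 + log² d`. -/
theorem sum_softmax_sq_sub_sq_le (lam : ℝ) (R : Fin d → ℝ) :
    lam ^ 2 * (∑ k, softmax lam R k * R k ^ 2 - (∑ k, softmax lam R k * R k) ^ 2)
      ≤ 1 + Real.log d ^ 2 := by
  have hd : (0 : ℝ) < d := by exact_mod_cast Nat.pos_of_ne_zero (NeZero.ne d)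
  have hd1 : (1 : ℝ) ≤ d := by exact_mod_cast Nat.one_le_iff_ne_zero.2 (NeZero.ne d)
  set x := softmax lam R with hx
  have hx0 := softmax_pos lam R
  have hs : ∑ k, x k = 1 := sum_softmax lam R
  set c := lse R lam - Real.log d
  -- Up to a constant, `lam * R` is the log-likelihood ratio to the uniform distribution, so its
  -- variance is at most the second moment of `log (d * x)`. Points with `d * x k ≤ 1` contribute at
  -- most `1 / d` each, the others at most `x k * log² d`.
  have h1 : ∀ k, lam * R k = Real.log (d * x k) + c := fun k => by
    rw [Real.log_mul hd.ne' (hx0 k).ne', log_softmax]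
    ring
  have h2 : ∑ k, x k * Real.log (d * x k) ^ 2 ≤ 1 + Real.log d ^ 2 := by
    have : ∀ k, x k * Real.log (d * x k) ^ 2 ≤ 1 / d + x k * Real.log d ^ 2 := fun k => by
      rcases le_total (d * x k) 1 with h | h
      · have := mul_log_sq_le_one (mul_pos hd (hx0 k)) h
        have h3 : x k * Real.log (d * x k) ^ 2 ≤ 1 / d := by
          rw [le_div_iff₀ hd]
          linarith
        have := mul_nonneg (hx0 k).le (sq_nonneg (Real.log d))
        linarith
      · have hle : Real.log (d * x k) ≤ Real.log d := by
          refine Real.log_le_log (by linarith) ?_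
          have : x k ≤ 1 := hs ▸ single_le_sum (f := x) (fun k _ => (hx0 k).le) (mem_univ k)
          nlinarith
        have h0 := Real.log_nonneg h
        have : Real.log (d * x k) ^ 2 ≤ Real.log d ^ 2 := by gcongr
        have := mul_le_mul_of_nonneg_left this (hx0 k).le
        have : (0 : ℝ) ≤ 1 / d := by positivity
        linarith
    refine (sum_le_sum fun k _ => this k).trans ?_
    rw [sum_add_distrib, ← sum_mul, hs]
    simp [hd.ne']
  have h3 : lam ^ 2 * ∑ k, x k * R k ^ 2
      = ∑ k, x k * Real.log (d * x k) ^ 2 + 2 * c * ∑ k, x k * Real.log (d * x k) + c ^ 2 := by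
    have : c ^ 2 = c ^ 2 * ∑ k, x k := by rw [hs, mul_one]
    rw [this, mul_sum, mul_sum, mul_sum, ← sum_add_distrib, ← sum_add_distrib]
    refine sum_congr rfl fun k _ => ?_
    linear_combination x k * (lam * R k + Real.log (d * x k) + c) * h1 k
  have h4 : lam * ∑ k, x k * R k = ∑ k, x k * Real.log (d * x k) + c := by
    have : c = c * ∑ k, x k := by rw [hs, mul_one]
    rw [this, mul_sum, mul_sum, ← sum_add_distrib]
    refine sum_congr rfl fun k _ => ?_
    linear_combination x k * h1 k
  have h5 : lam ^ 2 * (∑ k, x k * R k) ^ 2 = (∑ k, x k * Real.log (d * x k) + c) ^ 2 := by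
    rw [← h4]; ring
  rw [mul_sub, h3, h5]
  nlinarith [sq_nonneg (∑ k, x k * Real.log (d * x k))]

theorem hasDerivAt_lse (R : Fin d → ℝ) (lam : ℝ) :
    HasDerivAt (lse R) (R ⬝ᵥ softmax lam R) lam := by
  have h : HasDerivAt (partitionFn R) (∑ k, Real.exp (lam * R k) * R k) lam := by
    refine HasDerivAt.fun_sum fun k _ => ?_
    simpa using ((hasDerivAt_id lam).mul_const (R k)).exp
  have h2 : R ⬝ᵥ softmax lam R = (∑ k, Real.exp (lam * R k) * R k) / partitionFn R lam := by
    simp only [dotProduct]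
    rw [sum_div]
    refine sum_congr rfl fun k _ => ?_
    rw [softmax_eq]
    ring
  rw [h2]
  exact h.log (partitionFn_pos R lam).ne'

theorem hasDerivAt_dotProduct_softmax (R : Fin d → ℝ) (lam : ℝ) :
    HasDerivAt (fun l => R ⬝ᵥ softmax l R)
      (∑ k, softmax lam R k * R k ^ 2 - (∑ k, softmax lam R k * R k) ^ 2) lam := by
  have hx : ∀ k, HasDerivAt (fun l => softmax l R k)
      (softmax lam R k * (R k - R ⬝ᵥ softmax lam R)) lam := fun k => by
    have h1 : (fun l => softmax l R k) = fun l => Real.exp (l * R k - lse R l) := by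
      funext l
      rw [← log_softmax, Real.exp_log (softmax_pos l R k)]
    rw [h1]
    have h2 := ((((hasDerivAt_id lam).mul_const (R k)).sub (hasDerivAt_lse R lam))).exp
    have h3 : Real.exp (lam * R k - lse R lam) = softmax lam R k := by
      rw [← log_softmax, Real.exp_log (softmax_pos lam R k)]
    simpa [h3] using h2
  have h := HasDerivAt.fun_sum (u := univ) fun k _ => (hx k).const_mul (R k)
  refine h.congr_deriv ?_
  have : R ⬝ᵥ softmax lam R = ∑ k, softmax lam R k * R k := by
    simp only [dotProduct, mul_comm]
  rw [this, sq, mul_sum, ← sum_sub_distrib]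
  refine sum_congr rfl fun k _ => ?_
  ring

theorem concaveOn_lse_add_log (R : Fin d → ℝ) :
    ConcaveOn ℝ (Set.Ioi 0) fun l => lse R l + (1 + Real.log d ^ 2) * Real.log l := by
  have h1 : ∀ l ∈ Set.Ioi (0 : ℝ), HasDerivAt
      (fun l => lse R l + (1 + Real.log d ^ 2) * Real.log l)
      (R ⬝ᵥ softmax l R + (1 + Real.log d ^ 2) * l⁻¹) l := fun l hl =>
    (hasDerivAt_lse R l).add ((Real.hasDerivAt_log (ne_of_gt hl)).const_mul _)
  refine concaveOn_of_hasDerivWithinAt2_nonpos (convex_Ioi 0)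
    (f' := fun l => R ⬝ᵥ softmax l R + (1 + Real.log d ^ 2) * l⁻¹)
    (f'' := fun l => (∑ k, softmax l R k * R k ^ 2 - (∑ k, softmax l R k * R k) ^ 2)
      + (1 + Real.log d ^ 2) * (-(l ^ 2)⁻¹))
    (fun l hl => (h1 l hl).continuousAt.continuousWithinAt) ?_ ?_ ?_
  all_goals rw [interior_Ioi]
  · exact fun l hl => (h1 l hl).hasDerivWithinAt
  · exact fun l hl => ((hasDerivAt_dotProduct_softmax R l).add
      ((hasDerivAt_inv (ne_of_gt hl)).const_mul _)).hasDerivWithinAt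
  · intro l hl
    have hl : (0 : ℝ) < l := hl
    have h := sum_softmax_sq_sub_sq_le l R
    have h2 : 0 < l ^ 2 := by positivity
    have : (∑ k, softmax l R k * R k ^ 2 - (∑ k, softmax l R k * R k) ^ 2)
        ≤ (1 + Real.log d ^ 2) * (l ^ 2)⁻¹ := by
      rw [← div_eq_mul_inv, le_div_iff₀ h2]
      linarith
    linarith

theorem lse_tangent (R : Fin d → ℝ) {l l' : ℝ} (hl : 0 < l) (hl' : 0 < l') :
    lse R l' + (1 + Real.log d ^ 2) * Real.log l'
      ≤ lse R l + (1 + Real.log d ^ 2) * Real.log l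
        + (R ⬝ᵥ softmax l R + (1 + Real.log d ^ 2) / l) * (l' - l) := by
  have hc := concaveOn_lse_add_log R
  have hder : HasDerivAt (fun l => lse R l + (1 + Real.log d ^ 2) * Real.log l)
      (R ⬝ᵥ softmax l R + (1 + Real.log d ^ 2) / l) l :=
    (hasDerivAt_lse R l).add ((Real.hasDerivAt_log hl.ne').const_mul _)
  rcases lt_trichotomy l' l with h | h | h
  · have := hc.le_slope_of_hasDerivAt hl' hl h hder
    rw [slope_def_field, le_div_iff₀ (by linarith)] at this
    linarith
  · simp [h]
  · have := hc.slope_le_of_hasDerivAt hl hl' h hder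
    rw [slope_def_field, div_le_iff₀ (by linarith)] at this
    linarith

end Softmax

/-! ### Quadratic bounds for the divergence of `-log`. -/

section Quad

/-- The scalar Bregman divergence of `-log` as a function of the ratio of the arguments. -/
noncomputable def logGap (r : ℝ) : ℝ := r - 1 - Real.log r

theorem logGap_nonneg {r : ℝ} (hr : 0 < r) : 0 ≤ logGap r := by
  have := Real.log_le_sub_one_of_pos hr
  unfold logGap
  linarith

theorem abs_log_sub_le {z : ℝ} (hz : |z| ≤ 1 / 8) :
    |Real.log (1 + z) - z + z ^ 2 / 2| ≤ z ^ 2 / 7 := by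
  have h := Real.abs_log_sub_add_sum_range_le (x := -z) (by rw [abs_neg]; linarith) 2
  simp only [sum_range_succ, sum_range_zero, abs_neg] at h
  have e : (0 : ℝ) + (-z) ^ (0 + 1) / ((0 : ℕ) + 1) + (-z) ^ (1 + 1) / ((1 : ℕ) + 1)
      + Real.log (1 - -z) = Real.log (1 + z) - z + z ^ 2 / 2 := by
    rw [sub_neg_eq_add]
    push_cast
    ring
  rw [e] at h
  refine h.trans ?_
  rw [div_le_iff₀ (by linarith), ← sq_abs z]
  nlinarith [sq_nonneg |z|, abs_nonneg z]

theorem logGap_ge {r : ℝ} (hr : |r - 1| ≤ 1 / 8) : 35 / 100 * (r - 1) ^ 2 ≤ logGap r := by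
  have h := (abs_le.1 (abs_log_sub_le hr)).2
  rw [add_sub_cancel] at h
  unfold logGap
  nlinarith [sq_nonneg (r - 1)]

theorem logGap_inv_le {r : ℝ} (hr : |r - 1| ≤ 1 / 8) : logGap r⁻¹ ≤ 8 / 10 * (r - 1) ^ 2 := by
  have h := (abs_le.1 (abs_log_sub_le hr)).2
  rw [add_sub_cancel] at h
  have hr0 : 7 / 8 ≤ r := by linarith [(abs_le.1 hr).1]
  have hi : r⁻¹ - 1 + (r - 1) ≤ 8 / 7 * (r - 1) ^ 2 := by
    have e : r⁻¹ - 1 + (r - 1) = r⁻¹ * (r - 1) ^ 2 := by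
      field_simp
      ring
    have hb : r⁻¹ ≤ 8 / 7 := by
      rw [inv_le_comm₀ (by linarith) (by norm_num)]
      linarith
    rw [e]
    exact mul_le_mul_of_nonneg_right hb (sq_nonneg _)
  unfold logGap
  rw [Real.log_inv]
  nlinarith [sq_nonneg (r - 1)]

/-- Outside the interval, the tangents of `log` at `9/8` and `7/8` already make `logGap` too large.
The constant leaves room for `4 / (34 * 50)`, which is what stability of the rate supplies. -/
theorem abs_sub_one_le_of_logGap_le {r : ℝ} (hr : 0 < r)
    (h : logGap r ≤ 24 / 10000 * (1 + r)) : |r - 1| ≤ 1 / 8 := by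
  unfold logGap at h
  by_contra! hc
  rcases lt_abs.1 hc with h1 | h1
  · have h2 := Real.log_le_sub_one_of_pos (show 0 < r / (9 / 8) by positivity)
    rw [Real.log_div hr.ne' (by norm_num)] at h2
    have h3 := (abs_le.1 (abs_log_sub_le (z := 1 / 8) (by norm_num))).2
    norm_num at h3
    linarith
  · have h2 := Real.log_le_sub_one_of_pos (show 0 < r / (7 / 8) by positivity)
    rw [Real.log_div hr.ne' (by norm_num)] at h2
    have h3 := (abs_le.1 (abs_log_sub_le (z := -1 / 8) (by norm_num [abs_of_neg]))).2
    norm_num at h3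
    linarith

end Quad

/-! ### The lifted problem: stability of the rate, smoothness and convexity of the potential. -/

section Rate

variable {d : ℕ}

/-- `lam` solves the learning rate control problem with cap `η`. -/
structure IsRate (η α : ℝ) (R : Fin d → ℝ) (lam : ℝ) : Prop where
  pos : 0 < lam
  le : lam ≤ η
  max : ∀ l, 0 < l → l ≤ η → rateObjective α R l ≤ rateObjective α R lam

theorem rateObjective_eq (α : ℝ) (R : Fin d → ℝ) (lam : ℝ) :
    rateObjective α R lam = lse R lam + (α - 1) * Real.log lam := rfl

/-- The modulus of strong concavity (in `log lam`) of the rate objective. -/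
noncomputable def curvature (d : ℕ) (α : ℝ) : ℝ := α - 1 - (1 + Real.log d ^ 2)

/-- The suboptimality of the pair `(l', x')` in the lifted problem with optimal rate `l`. -/
noncomputable def liftedGap (α : ℝ) (R : Fin d → ℝ) (l l' : ℝ) (x' : Fin d → ℝ) : ℝ :=
  rateObjective α R l - rateObjective α R l' + relEntropy x' (softmax l' R)

variable [NeZero d]

theorem hasDerivAt_rateObjective (α : ℝ) (R : Fin d → ℝ) {l : ℝ} (hl : 0 < l) :
    HasDerivAt (rateObjective α R) (R ⬝ᵥ softmax l R + (α - 1) / l) l :=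
  (hasDerivAt_lse R l).add ((Real.hasDerivAt_log hl.ne').const_mul _)

/-- The part of the logarithmic term not needed to make `lse` concave leaves a strict gain over the
tangent line, measured by `logGap`. -/
theorem rateObjective_le_of_deriv {α : ℝ} {R : Fin d → ℝ} {l l' : ℝ} (hl : 0 < l) (hl' : 0 < l')
    (h : (R ⬝ᵥ softmax l R + (α - 1) / l) * (l' - l) ≤ 0) :
    rateObjective α R l' + curvature d α * logGap (l' / l) ≤ rateObjective α R l := by
  have ht := lse_tangent R hl hl'
  rw [rateObjective_eq, rateObjective_eq, curvature, logGap, Real.log_div hl'.ne' hl.ne']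
  have e : l' / l - 1 = (l' - l) / l := by field_simp
  rw [e]
  have e2 : (R ⬝ᵥ softmax l R + (1 + Real.log d ^ 2) / l) * (l' - l)
      = (R ⬝ᵥ softmax l R + (α - 1) / l) * (l' - l)
        - (α - 1 - (1 + Real.log d ^ 2)) * ((l' - l) / l) := by ring
  linarith

theorem IsRate.gap {η α : ℝ} {R : Fin d → ℝ} {l l' : ℝ} (h : IsRate η α R l) (hl' : 0 < l')
    (hle : l' ≤ η) :
    rateObjective α R l' + curvature d α * logGap (l' / l) ≤ rateObjective α R l := by
  refine rateObjective_le_of_deriv h.pos hl' ?_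
  -- The maximizer may be the endpoint `η`, so only the one-sided first-order condition towards `l'`
  -- is available; that is all the tangent bound needs.
  have hmax : IsMaxOn (rateObjective α R) (Set.Ioc 0 η) l := fun y hy => h.max y hy.1 hy.2
  have hd := (hasDerivAt_rateObjective α R h.pos).hasFDerivAt.hasFDerivWithinAt (s := Set.Ioc 0 η)
  have := hmax.localize.hasFDerivWithinAt_nonpos hd
    (sub_mem_posTangentConeAt_of_segment_subset
      ((convex_Ioc 0 η).segment_subset ⟨h.pos, h.le⟩ ⟨hl', hle⟩))
  simpa [mul_comm] using this

theorem rateObjective_sub_sub_eq (α : ℝ) (R R' : Fin d → ℝ) (l l' : ℝ) :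
    rateObjective α R' l' - rateObjective α R l - l * ((R' - R) ⬝ᵥ softmax l R)
      = l' * ((R' - R) ⬝ᵥ softmax l' R') - l * ((R' - R) ⬝ᵥ softmax l R)
        - liftedGap α R l l' (softmax l' R') := by
  rw [liftedGap, relEntropy_softmax _ (softmax_pos l' R') (sum_softmax l' R'),
    sum_softmax_mul_log]
  simp only [rateObjective_eq, sub_dotProduct]
  ring

/-- Fenchel duality: the Bregman remainder of the potential is the suboptimality of the old pair in
the new problem. Together with `rateObjective_sub_sub_eq` it expresses the sum of the two opposite
gaps as a linear term. Both identities are exact for arbitrary rates. -/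
theorem rateObjective_sub_sub_eq_liftedGap (α : ℝ) (R R' : Fin d → ℝ) (l l' : ℝ) :
    rateObjective α R' l' - rateObjective α R l - l * ((R' - R) ⬝ᵥ softmax l R)
      = liftedGap α R' l' l (softmax l R) := by
  rw [liftedGap, relEntropy_softmax _ (softmax_pos l R) (sum_softmax l R),
    sum_softmax_mul_log]
  simp only [rateObjective_eq, sub_dotProduct]
  ring

/-- With `R` fixed, this relative entropy is the Bregman divergence of `lse R` in the rate, which
`lse_tangent` controls. -/
theorem relEntropy_softmax_rate_le (R : Fin d → ℝ) {l l' : ℝ} (hl : 0 < l) (hl' : 0 < l') :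
    relEntropy (softmax l' R) (softmax l R) ≤ (1 + Real.log d ^ 2) * logGap (l / l') := by
  rw [relEntropy_softmax _ (softmax_pos l' R) (sum_softmax l' R), sum_softmax_mul_log, logGap,
    Real.log_div hl.ne' hl'.ne']
  have := lse_tangent R hl' hl
  have e : l / l' - 1 = (l - l') / l' := by field_simp
  have e2 : (R ⬝ᵥ softmax l' R + (1 + Real.log d ^ 2) / l') * (l - l')
      = R ⬝ᵥ softmax l' R * (l - l') + (1 + Real.log d ^ 2) * ((l - l') / l') := by ring
  rw [e]
  linarith

/-- The conditions on the parameters under which the learning rate is stable. -/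
structure GoodParams (d : ℕ) (η α : ℝ) : Prop where
  pos : 0 < η
  le : η ≤ 1 / 50
  le_curvature : 34 ≤ curvature d α
  var_le_curvature : 22 * (1 + Real.log d ^ 2) ≤ curvature d α

variable {η α : ℝ} {R R' : Fin d → ℝ} {l l' : ℝ}

theorem IsRate.curvature_mul_le_liftedGap (h : IsRate η α R l) (h' : IsRate η α R' l') :
    curvature d α * logGap (l' / l) + relEntropy (softmax l' R') (softmax l' R)
      ≤ liftedGap α R l l' (softmax l' R') := by
  have := h.gap h'.pos h'.le
  unfold liftedGap
  linarith

theorem relEntropy_softmax_nonneg (l l' : ℝ) (R R' : Fin d → ℝ) :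
    0 ≤ relEntropy (softmax l R) (softmax l' R') :=
  relEntropy_nonneg _ _ (softmax_pos _ _) (softmax_pos _ _) (sum_softmax _ _) (sum_softmax _ _)

theorem sq_dist1_softmax_le (l l' : ℝ) (R R' : Fin d → ℝ) :
    dist1 (softmax l R) (softmax l' R') ^ 2 ≤ 4 * relEntropy (softmax l R) (softmax l' R') :=
  sq_dist1_le_relEntropy _ _ (softmax_pos _ _) (softmax_pos _ _) (sum_softmax _ _) (sum_softmax _ _)

theorem IsRate.liftedGap_nonneg (hp : GoodParams d η α) (h : IsRate η α R l)
    (h' : IsRate η α R' l') : 0 ≤ liftedGap α R l l' (softmax l' R') := by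
  have h1 := h.curvature_mul_le_liftedGap h'
  have h2 := relEntropy_softmax_nonneg l' l' R' R
  have h3 := logGap_nonneg (div_pos h'.pos h.pos)
  have h4 := hp.le_curvature
  nlinarith

/-- The two opposite lifted gaps add up to a linear term of size at most `4 * (l + l')`; one is
nonnegative and the other contains `curvature d α * logGap (l' / l)`. -/
theorem IsRate.stable (hp : GoodParams d η α) (h : IsRate η α R l) (h' : IsRate η α R' l')
    (hR : ∀ k, |(R' - R) k| ≤ 4) : |l' / l - 1| ≤ 1 / 8 := by
  have e1 := rateObjective_sub_sub_eq α R R' l l'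
  rw [rateObjective_sub_sub_eq_liftedGap] at e1
  have h0 := h'.liftedGap_nonneg hp h
  have h1 := h.curvature_mul_le_liftedGap h'
  have h2 := relEntropy_softmax_nonneg l' l' R' R
  have a1 := (abs_le.1 (abs_dotProduct_le (softmax_mem l' R') hR)).2
  have a2 := (abs_le.1 (abs_dotProduct_le (softmax_mem l R) hR)).1
  have b1 := mul_le_mul_of_nonneg_left a1 h'.pos.le
  have b2 := mul_le_mul_of_nonneg_left a2 h.pos.le
  have hr := div_pos h'.pos h.pos
  refine abs_sub_one_le_of_logGap_le hr ?_
  have h3 := logGap_nonneg hr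
  have h4 : 34 * logGap (l' / l) ≤ 4 * (l + l') := by
    have := mul_le_mul_of_nonneg_right hp.le_curvature h3
    linarith
  have h5 : l + l' = l * (1 + l' / l) := by
    have := h.pos.ne'
    field_simp
  have h6 : l * (1 + l' / l) ≤ 1 / 50 * (1 + l' / l) :=
    mul_le_mul_of_nonneg_right (h.le.trans hp.le) (by linarith)
  linarith

/-- Pass from `(l, R)` to `(l', R')` through `(l', R)`. The relative entropy in the gap pays for the
change of `R`; the change of rate costs only a multiple of `1 + log² d`, which the curvature
absorbs. -/
theorem IsRate.liftedGap_ge (hp : GoodParams d η α) (h : IsRate η α R l) (h' : IsRate η α R' l')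
    (hR : ∀ k, |(R' - R) k| ≤ 4) :
    15 / 100 * dist1 (softmax l' R') (softmax l R) ^ 2
      + 1 / 4 * curvature d α * (l' / l - 1) ^ 2 ≤ liftedGap α R l l' (softmax l' R') := by
  have hst := h.stable hp h' hR
  have h1 := h.curvature_mul_le_liftedGap h'
  have hK := hp.le_curvature
  have q1 := mul_le_mul_of_nonneg_left (logGap_ge hst) (by linarith : 0 ≤ curvature d α)
  have q2 := logGap_inv_le hst
  rw [inv_div] at q2
  have a := sq_dist1_softmax_le l' l' R' R
  have b := sq_dist1_softmax_le l' l R R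
  have b' := relEntropy_softmax_rate_le R h.pos h'.pos
  have hV : 0 ≤ 1 + Real.log d ^ 2 := by positivity
  have c := mul_le_mul_of_nonneg_left q2 hV
  have c2 := mul_le_mul_of_nonneg_right hp.var_le_curvature (sq_nonneg (l' / l - 1))
  have t := dist1_triangle (softmax l' R') (softmax l' R) (softmax l R)
  set A := dist1 (softmax l' R') (softmax l' R)
  set B := dist1 (softmax l' R) (softmax l R)
  have t2 : dist1 (softmax l' R') (softmax l R) ^ 2 ≤ 3 / 2 * A ^ 2 + 3 * B ^ 2 := by
    have := dist1_nonneg (softmax l' R') (softmax l R)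
    have : dist1 (softmax l' R') (softmax l R) ^ 2 ≤ (A + B) ^ 2 := by gcongr
    nlinarith [sq_nonneg (A - 2 * B)]
  nlinarith

/-- Strong smoothness of the potential. -/
theorem IsRate.potential_le (hp : GoodParams d η α) (h : IsRate η α R l) (h' : IsRate η α R' l')
    {s N W : ℝ} (hR : ∀ k, |(R' - R) k| ≤ W) (hW : W ≤ 4) (hN : ∀ k, |(R' - R) k - s| ≤ N) :
    rateObjective α R' l' - rateObjective α R l - l * ((R' - R) ⬝ᵥ softmax l R)
      ≤ 5 * η ^ 2 * N ^ 2 + 3 / 100 * η ^ 2 * W ^ 2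
        - 1 / 10 * dist1 (softmax l R) (softmax l' R') ^ 2 := by
  rw [rateObjective_sub_sub_eq]
  have hg := h.liftedGap_ge hp h' fun k => (hR k).trans hW
  rw [dist1_comm] at hg
  set X := dist1 (softmax l R) (softmax l' R') with hX
  have hX0 : 0 ≤ X := dist1_nonneg _ _
  have hW0 : 0 ≤ W := (abs_nonneg _).trans (hR 0)
  have hN0 : 0 ≤ N := (abs_nonneg _).trans (hN 0)
  have hK := hp.le_curvature
  have hη := hp.pos
  -- A constant shift `s` is invisible to the difference of two distributions, so only the centred
  -- size `N` enters here; the full size `W` enters only through the change of rate.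
  have e1 : (R' - R) ⬝ᵥ softmax l' R' - (R' - R) ⬝ᵥ softmax l R ≤ N * X := by
    have := (abs_le.1 (abs_sum_mul_sub_le (p := softmax l' R') (q := softmax l R) hN)).2
    rw [dist1_comm, ← hX] at this
    have e : ∑ k, ((R' - R) k - s) * (softmax l' R' k - softmax l R k)
        = (R' - R) ⬝ᵥ softmax l' R' - (R' - R) ⬝ᵥ softmax l R := by
      have : ∑ k, s * (softmax l' R' k - softmax l R k) = 0 := by
        rw [← mul_sum, sum_sub_distrib, sum_softmax, sum_softmax]
        ring
      simp only [dotProduct]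
      simp only [sub_mul, sum_sub_distrib, this, sub_zero]
      simp only [mul_sub, sum_sub_distrib]
    linarith
  have e2 := abs_dotProduct_le (softmax_mem l' R') hR
  have e3 : l' * ((R' - R) ⬝ᵥ softmax l' R') - l * ((R' - R) ⬝ᵥ softmax l R)
      = l * ((R' - R) ⬝ᵥ softmax l' R' - (R' - R) ⬝ᵥ softmax l R)
        + l * ((l' / l - 1) * ((R' - R) ⬝ᵥ softmax l' R')) := by
    have := h.pos.ne'
    field_simp
    ring
  have e4 : (l' / l - 1) * ((R' - R) ⬝ᵥ softmax l' R') ≤ |l' / l - 1| * W := by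
    refine (le_abs_self _).trans ?_
    rw [abs_mul]
    exact mul_le_mul_of_nonneg_left e2 (abs_nonneg _)
  have f1 : l * ((R' - R) ⬝ᵥ softmax l' R' - (R' - R) ⬝ᵥ softmax l R) ≤ η * (N * X) :=
    (mul_le_mul_of_nonneg_left e1 h.pos.le).trans
      (mul_le_mul_of_nonneg_right h.le (by positivity))
  have f2 : l * ((l' / l - 1) * ((R' - R) ⬝ᵥ softmax l' R')) ≤ η * (|l' / l - 1| * W) :=
    (mul_le_mul_of_nonneg_left e4 h.pos.le).trans
      (mul_le_mul_of_nonneg_right h.le (by positivity))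
  rw [← sq_abs (l' / l - 1)] at hg
  set z := |l' / l - 1|
  have g1 : η * (N * X) ≤ 5 * η ^ 2 * N ^ 2 + 1 / 20 * X ^ 2 := by
    nlinarith [sq_nonneg (10 * (η * N) - X)]
  -- Young's inequality closes because `4 * (3 / 100) * (34 / 4) > 1`; this is the use of the bound
  -- `34` on the curvature.
  have g2 : η * (z * W) ≤ 3 / 100 * η ^ 2 * W ^ 2 + 1 / 4 * curvature d α * z ^ 2 := by
    nlinarith [sq_nonneg (η * W - 17 * z), sq_nonneg z, sq_nonneg (η * W),
      mul_le_mul_of_nonneg_right hK (sq_nonneg z)]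
  linarith

/-- Strong convexity of the potential. -/
theorem IsRate.le_potential (hp : GoodParams d η α) (h : IsRate η α R l) (h' : IsRate η α R' l')
    (hR : ∀ k, |(R' - R) k| ≤ 4) :
    15 / 100 * dist1 (softmax l R) (softmax l' R') ^ 2
      ≤ rateObjective α R' l' - rateObjective α R l - l * ((R' - R) ⬝ᵥ softmax l R) := by
  rw [rateObjective_sub_sub_eq_liftedGap]
  have := h'.liftedGap_ge hp h fun k => by
    have := hR k
    rwa [Pi.sub_apply, abs_sub_comm] at this
  have hK := hp.le_curvature
  nlinarith [sq_nonneg (l / l' - 1)]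

end Rate

/-! ### Admissibility of the parameters. -/

section Params

theorem log_two_le_log {d : ℕ} (hd : 2 ≤ d) : 693 / 1000 ≤ Real.log d := by
  have h1 : Real.log 2 ≤ Real.log d := Real.log_le_log (by norm_num) (by exact_mod_cast hd)
  linarith [Real.log_two_gt_d9]

theorem etaOf_pos {n : ℕ} {L : ℝ} (hn : 1 ≤ n) (hL : 0 < L) : 0 < etaOf n L := by
  have hn' : (0 : ℝ) < n := by exact_mod_cast hn
  unfold etaOf
  positivity

/-- The curvature is `2 * log d + (β - 1) * log² d`; `β ≥ 70` makes both lower bounds hold already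
at `d = 2`. -/
theorem goodParams {n d : ℕ} {L β : ℝ} (hn : 1 ≤ n) (hd : 2 ≤ d) (hL : 0 < L) (hβ : 70 ≤ β) :
    GoodParams d (etaOf n L) (alphaOf d β) where
  pos := etaOf_pos hn hL
  le := min_le_left _ _
  le_curvature := by
    have h := log_two_le_log hd
    unfold curvature alphaOf
    nlinarith [mul_le_mul_of_nonneg_right hβ (sq_nonneg (Real.log d))]
  var_le_curvature := by
    have h := log_two_le_log hd
    unfold curvature alphaOf
    nlinarith [mul_le_mul_of_nonneg_right hβ (sq_nonneg (Real.log d))]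

variable {d : ℕ} {η α : ℝ}

theorem GoodParams.one_le_alpha (hp : GoodParams d η α) : 1 ≤ α := by
  have := hp.le_curvature
  unfold curvature at this
  nlinarith [sq_nonneg (Real.log d)]

end Params

/-! ### The algorithm's rate solves the control problem. -/

section LearningRate

variable {d : ℕ} [NeZero d] {η β : ℝ}

omit [NeZero d] in
theorem lse_zero_right (R : Fin d → ℝ) : lse R 0 = Real.log d := by
  simp [lse, partitionFn]

theorem neg_log_le_sum_softmax_mul_log (lam : ℝ) (R : Fin d → ℝ) :
    -Real.log d ≤ ∑ k, softmax lam R k * Real.log (softmax lam R k) := by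
  have := relEntropy_softmax_nonneg lam 0 R R
  rw [relEntropy_softmax _ (softmax_pos lam R) (sum_softmax lam R), lse_zero_right] at this
  linarith

theorem lse_le_log_card {R : Fin d → ℝ} {l : ℝ} (hl : 0 ≤ l) (hR : ∀ k, R k ≤ 0) :
    lse R l ≤ Real.log d := by
  refine Real.log_le_log (partitionFn_pos R l) ?_
  calc partitionFn R l ≤ ∑ _k : Fin d, (1 : ℝ) :=
        sum_le_sum fun k _ => Real.exp_le_one_iff.2 (mul_nonpos_of_nonneg_of_nonpos hl (hR k))
    _ = d := by simp

theorem exists_isRate {α : ℝ} (hη : 0 < η) (hα : 1 < α) {R : Fin d → ℝ} (hR : ∀ k, R k ≤ 0) :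
    ∃ l, IsRate η α R l := by
  -- `Set.Ioc 0 η` is not compact. Since `lse R ≤ log d` for nonpositive `R`, rates below `c` do no
  -- better than `η`, so a compact interval suffices.
  set c := Real.exp ((rateObjective α R η - Real.log d) / (α - 1)) with hc
  set δ := min η c with hδ
  have hδ0 : 0 < δ := lt_min hη (Real.exp_pos _)
  have hcont : ContinuousOn (rateObjective α R) (Set.Icc δ η) := fun l hl =>
    (hasDerivAt_rateObjective α R (hδ0.trans_le hl.1)).continuousAt.continuousWithinAt
  obtain ⟨m, hm, hmax⟩ := isCompact_Icc.exists_isMaxOn ⟨η, min_le_left _ _, le_rfl⟩ hcont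
  refine ⟨m, hδ0.trans_le hm.1, hm.2, fun l hl hle => ?_⟩
  rcases le_or_gt δ l with h | h
  · exact hmax ⟨h, hle⟩
  · refine le_trans ?_ (hmax (⟨min_le_left _ _, le_rfl⟩ : η ∈ Set.Icc δ η))
    have h1 : Real.log l ≤ (rateObjective α R η - Real.log d) / (α - 1) := by
      rw [Real.log_le_iff_le_exp hl]
      exact h.le.trans (min_le_right _ _)
    rw [le_div_iff₀ (by linarith)] at h1
    have h2 := lse_le_log_card hl.le hR
    rw [rateObjective_eq α R l]
    linarith

/-- Both branches maximize the same objective. Above the cutoff `-β log² d` the derivative at `η` is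
nonnegative, as `α - 1` covers the entropy and the cutoff; so `η` is optimal. -/
theorem learningRate_isRate (hη : 0 < η) (hη1 : η ≤ 1) (hβ : 70 ≤ β)
    (hp : GoodParams d η (alphaOf d β)) (R : Fin d → ℝ) :
    IsRate η (alphaOf d β) R (learningRate η (alphaOf d β) β R) := by
  have hlog : 0 ≤ Real.log d := Real.log_natCast_nonneg d
  have hb : 0 ≤ β * Real.log d ^ 2 := by positivity
  unfold learningRate
  split_ifs with h
  · obtain ⟨k, hk⟩ := exists_eq_ciSup_of_finite (f := R)
    rw [← hk] at h
    refine ⟨hη, le_rfl, fun l hl hle => ?_⟩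
    have hder : 0 ≤ R ⬝ᵥ softmax η R + (alphaOf d β - 1) / η := by
      have e1 := neg_log_le_sum_softmax_mul_log η R
      rw [sum_softmax_mul_log] at e1
      have e2 := mul_le_lse R η k
      have e3 := mul_le_mul_of_nonneg_left h hη.le
      have e4 : η * (β * Real.log d ^ 2) ≤ 1 * (β * Real.log d ^ 2) :=
        mul_le_mul_of_nonneg_right hη1 hb
      have e5 : R ⬝ᵥ softmax η R + (alphaOf d β - 1) / η
          = (η * (R ⬝ᵥ softmax η R) + (alphaOf d β - 1)) / η := by field_simp
      rw [e5]
      refine div_nonneg ?_ hη.le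
      unfold alphaOf
      linarith
    have := rateObjective_le_of_deriv (α := alphaOf d β) (R := R) hη hl
      (mul_nonpos_of_nonneg_of_nonpos hder (by linarith))
    have h3 := mul_nonneg ((by norm_num : (0 : ℝ) ≤ 34).trans hp.le_curvature)
      (logGap_nonneg (div_pos hl hη))
    linarith
  · push Not at h
    have hR : ∀ k, R k ≤ 0 := fun k =>
      (le_ciSup (Set.finite_range R).bddAbove k).trans (by linarith)
    have hα : 1 < alphaOf d β := by
      unfold alphaOf
      linarith
    obtain ⟨l, hl⟩ := exists_isRate hη hα hR
    have hex : ∃ lam : ℝ, lam ∈ Set.Ioc 0 η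
        ∧ IsMaxOn (rateObjective (alphaOf d β) R) (Set.Ioc 0 η) lam :=
      ⟨l, ⟨hl.pos, hl.le⟩, fun y hy => hl.max y hy.1 hy.2⟩
    obtain ⟨h1, h2⟩ := Classical.epsilon_spec hex
    exact ⟨h1.1, h1.2, fun y hy hy' => h2 ⟨hy, hy'⟩⟩

end LearningRate

/-! ### Potential argument and the RVU bound. -/

section Dynamics

variable {d : ℕ} (η α β : ℝ) (ν : ℕ → Fin d → ℝ)

/-- The cumulative corrected utility of DLRC-OMWU against `ν`. -/
noncomputable def dlrcCum (t : ℕ) : Fin d → ℝ :=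
  ((dlrcOMWU d η α β).stateAgainst ν t).cumulative

/-- The optimistic prediction of DLRC-OMWU against `ν`. -/
noncomputable def dlrcLast (t : ℕ) : Fin d → ℝ :=
  ((dlrcOMWU d η α β).stateAgainst ν t).last

/-- The strategies of DLRC-OMWU against `ν`. -/
noncomputable def dlrcPlay (t : ℕ) : Fin d → ℝ := (dlrcOMWU d η α β).playAgainst ν t

/-- The corrected utilities of DLRC-OMWU against `ν`. -/
noncomputable def dlrcCorr (t : ℕ) : Fin d → ℝ := fun k => ν t k - ν t ⬝ᵥ dlrcPlay η α β ν t

/-- The strategy that the lifted follow-the-regularized-leader plays at `R`. -/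
noncomputable def leader (R : Fin d → ℝ) : Fin d → ℝ := softmax (learningRate η α β R) R

/-- The value of the lifted problem at `R`. -/
noncomputable def potential (R : Fin d → ℝ) : ℝ := rateObjective α R (learningRate η α β R)

theorem dlrcCum_zero : dlrcCum η α β ν 0 = 0 := rfl

theorem dlrcLast_zero : dlrcLast η α β ν 0 = 0 := rfl

theorem dlrcCum_succ (t : ℕ) :
    dlrcCum η α β ν (t + 1) = dlrcCum η α β ν t + dlrcCorr η α β ν t := rfl

theorem dlrcLast_succ (t : ℕ) : dlrcLast η α β ν (t + 1) = dlrcCorr η α β ν t := rfl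

theorem dlrcCum_apply (T : ℕ) (k : Fin d) :
    dlrcCum η α β ν T k = ∑ t ∈ range T, (ν t k - ν t ⬝ᵥ dlrcPlay η α β ν t) := by
  induction T with
  | zero => simp [dlrcCum_zero]
  | succ T ih => rw [dlrcCum_succ, sum_range_succ, ← ih]; rfl

variable [NeZero d]

theorem dlrcPlay_mem (t : ℕ) : dlrcPlay η α β ν t ∈ stdSimplex ℝ (Fin d) := softmax_mem _ _

theorem dlrcCorr_dotProduct_play (t : ℕ) : dlrcCorr η α β ν t ⬝ᵥ dlrcPlay η α β ν t = 0 := by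
  have h : ∑ k, dlrcPlay η α β ν t k = 1 := (dlrcPlay_mem η α β ν t).2
  have e : ∀ k, dlrcCorr η α β ν t k * dlrcPlay η α β ν t k
      = ν t k * dlrcPlay η α β ν t k
        - (ν t ⬝ᵥ dlrcPlay η α β ν t) * dlrcPlay η α β ν t k := fun k => by
    rw [dlrcCorr]
    ring
  rw [dotProduct, sum_congr rfl fun k _ => e k, sum_sub_distrib, ← mul_sum, h, mul_one]
  exact sub_self _

variable {ν}

theorem abs_dlrcCorr_le (hν : ∀ t k, |ν t k| ≤ 1) (t : ℕ) (k : Fin d) :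
    |dlrcCorr η α β ν t k| ≤ 2 := by
  have h1 := abs_le.1 (hν t k)
  have h2 := abs_le.1 (abs_dotProduct_le (dlrcPlay_mem η α β ν t) (hν t))
  rw [dlrcCorr, abs_le]
  constructor <;> linarith

theorem abs_dlrcLast_le (hν : ∀ t k, |ν t k| ≤ 1) (t : ℕ) (k : Fin d) :
    |dlrcLast η α β ν t k| ≤ 2 := by
  cases t with
  | zero => simp [dlrcLast_zero]
  | succ t => exact abs_dlrcCorr_le η α β hν t k

theorem abs_dlrcCorr_sub_le (hν : ∀ t k, |ν t k| ≤ 1) (t : ℕ) (k : Fin d) :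
    |dlrcCorr η α β ν (t + 1) k - dlrcCorr η α β ν t k|
      ≤ 2 * ‖ν (t + 1) - ν t‖ + dist1 (dlrcPlay η α β ν (t + 1)) (dlrcPlay η α β ν t) := by
  have hk : ∀ k, |(ν (t + 1) - ν t) k| ≤ ‖ν (t + 1) - ν t‖ := fun k =>
    norm_le_pi_norm (ν (t + 1) - ν t) k
  have h1 := abs_le.1 (hk k)
  have h2 := abs_le.1 (abs_dotProduct_le (dlrcPlay_mem η α β ν (t + 1)) hk)
  have h3 := abs_le.1 (abs_sum_mul_sub_le (p := dlrcPlay η α β ν (t + 1))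
    (q := dlrcPlay η α β ν t) (hν t))
  have e : ∑ k, ν t k * (dlrcPlay η α β ν (t + 1) k - dlrcPlay η α β ν t k)
      = ν t ⬝ᵥ dlrcPlay η α β ν (t + 1) - ν t ⬝ᵥ dlrcPlay η α β ν t := by
    simp only [dotProduct, mul_sub, sum_sub_distrib]
  rw [e] at h3
  rw [sub_dotProduct] at h2
  rw [Pi.sub_apply] at h1
  simp only [dlrcCorr]
  rw [abs_le]
  constructor <;> linarith

variable {η β}
variable (hη : 0 < η) (hη1 : η ≤ 1) (hβ : 70 ≤ β) (hp : GoodParams d η (alphaOf d β))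
  (hν : ∀ t k, |ν t k| ≤ 1)

include hη hη1 hβ hp hν

/-- Compare both `U + u` and `U` with the optimistic point `U + m`, by smoothness and by convexity.
The linear terms in `m` cancel, and the one in `u` vanishes because the corrected utility is
orthogonal to the play. -/
theorem potential_step_le {s N W : ℝ} (t : ℕ)
    (hW : ∀ k, |dlrcCorr η (alphaOf d β) β ν t k - dlrcLast η (alphaOf d β) β ν t k| ≤ W)
    (hW4 : W ≤ 4)
    (hN : ∀ k, |dlrcCorr η (alphaOf d β) β ν t k - dlrcLast η (alphaOf d β) β ν t k - s| ≤ N) :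
    potential η (alphaOf d β) β (dlrcCum η (alphaOf d β) β ν (t + 1))
        + 1 / 10 * dist1 (dlrcPlay η (alphaOf d β) β ν t)
          (leader η (alphaOf d β) β (dlrcCum η (alphaOf d β) β ν (t + 1))) ^ 2
        + 15 / 100 * dist1 (dlrcPlay η (alphaOf d β) β ν t)
          (leader η (alphaOf d β) β (dlrcCum η (alphaOf d β) β ν t)) ^ 2
      ≤ potential η (alphaOf d β) β (dlrcCum η (alphaOf d β) β ν t)
        + 5 * η ^ 2 * N ^ 2 + 3 / 100 * η ^ 2 * W ^ 2 := by
  set α := alphaOf d β with hα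
  set U := dlrcCum η α β ν t with hU
  set m := dlrcLast η α β ν t with hm
  set u := dlrcCorr η α β ν t with hu
  have hx : dlrcPlay η α β ν t = leader η α β (U + m) := rfl
  have hU1 : dlrcCum η α β ν (t + 1) = U + u := rfl
  have hux : u ⬝ᵥ leader η α β (U + m) = 0 := dlrcCorr_dotProduct_play η α β ν t
  rw [hU1, hx]
  have r0 := learningRate_isRate hη hη1 hβ hp (U + m)
  have r1 := learningRate_isRate hη hη1 hβ hp (U + u)
  have r2 := learningRate_isRate hη hη1 hβ hp U
  have e1 : U + u - (U + m) = u - m := by abel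
  have e2 : U - (U + m) = -m := by abel
  have A := r0.potential_le hp r1 (s := s) (N := N) (W := W)
    (by rw [e1]; exact hW) hW4 (by rw [e1]; exact hN)
  have B := r0.le_potential hp r2 (by
    rw [e2]
    intro k
    rw [Pi.neg_apply, abs_neg]
    linarith [abs_dlrcLast_le η α β hν t k])
  rw [e1, sub_dotProduct] at A
  rw [e2, neg_dotProduct] at B
  change u ⬝ᵥ softmax (learningRate η α β (U + m)) (U + m) = 0 at hux
  rw [hux] at A
  simp only [potential, leader]
  linarith

theorem potential_le (T : ℕ) :
    potential η (alphaOf d β) β (dlrcCum η (alphaOf d β) β ν (T + 1))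
        + 1 / 10 * dist1 (dlrcPlay η (alphaOf d β) β ν T)
          (leader η (alphaOf d β) β (dlrcCum η (alphaOf d β) β ν (T + 1))) ^ 2
      ≤ potential η (alphaOf d β) β (0 : Fin d → ℝ) + 6 * η ^ 2
        + ∑ t ∈ range T, (6 * η ^ 2 * ‖ν (t + 1) - ν t‖ ^ 2
          - 1 / 24 * dist1 (dlrcPlay η (alphaOf d β) β ν (t + 1))
            (dlrcPlay η (alphaOf d β) β ν t) ^ 2) := by
  have hη50 := hp.le
  induction T with
  | zero =>
    -- There is no prediction in the first round, so the increment is the whole corrected utility.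
    have h := potential_step_le hη hη1 hβ hp hν (s := -(ν 0 ⬝ᵥ dlrcPlay η (alphaOf d β) β ν 0))
      (N := 1) (W := 2) 0
      (fun k => by simpa [dlrcLast_zero] using abs_dlrcCorr_le η (alphaOf d β) β hν 0 k)
      (by norm_num) (fun k => by simpa [dlrcLast_zero, dlrcCorr] using hν 0 k)
    rw [dlrcCum_zero] at h
    simp only [range_zero, sum_empty]
    have := sq_nonneg (dist1 (dlrcPlay η (alphaOf d β) β ν 0) (leader η (alphaOf d β) β 0))
    nlinarith [sq_nonneg η]
  | succ T ih =>
    set α := alphaOf d β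
    set N := ‖ν (T + 1) - ν T‖
    set D := dist1 (dlrcPlay η α β ν (T + 1)) (dlrcPlay η α β ν T) with hD
    have hN0 : 0 ≤ N := norm_nonneg _
    have hD0 : 0 ≤ D := dist1_nonneg _ _
    -- The shift `s` removes the change of the mean, leaving `N` equal to the raw variation. The
    -- minimum with `4` keeps `W` admissible.
    have h := potential_step_le hη hη1 hβ hp hν
      (s := -(ν (T + 1) ⬝ᵥ dlrcPlay η α β ν (T + 1) - ν T ⬝ᵥ dlrcPlay η α β ν T))
      (N := N) (W := min 4 (2 * N + D)) (T + 1)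
      (fun k => le_min (by
          have h1 := abs_le.1 (abs_dlrcCorr_le η α β hν (T + 1) k)
          have h2 := abs_le.1 (abs_dlrcCorr_le η α β hν T k)
          rw [dlrcLast_succ, abs_le]
          constructor <;> linarith)
        (abs_dlrcCorr_sub_le η α β hν T k))
      (min_le_left _ _) (fun k => by
        have := norm_le_pi_norm (ν (T + 1) - ν T) k
        rw [dlrcLast_succ]
        simp only [dlrcCorr]
        rw [Pi.sub_apply, Real.norm_eq_abs] at this
        convert this using 2
        ring)
    have hW : min 4 (2 * N + D) ^ 2 ≤ (2 * N + D) ^ 2 := by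
      have : 0 ≤ min 4 (2 * N + D) := le_min (by norm_num) (by positivity)
      gcongr
      exact min_le_right _ _
    have hW2 : (2 * N + D) ^ 2 ≤ 8 * N ^ 2 + 2 * D ^ 2 := by nlinarith [sq_nonneg (2 * N - D)]
    have hW3 : 3 / 100 * η ^ 2 * min 4 (2 * N + D) ^ 2
        ≤ 24 / 100 * η ^ 2 * N ^ 2 + 6 / 100 * η ^ 2 * D ^ 2 := by
      have := mul_le_mul_of_nonneg_left (hW.trans hW2) (sq_nonneg η)
      linarith
    have hη2 : η ^ 2 * D ^ 2 ≤ 1 / 2500 * D ^ 2 := by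
      refine mul_le_mul_of_nonneg_right ?_ (sq_nonneg D)
      nlinarith
    have htri : D ≤ dist1 (dlrcPlay η α β ν (T + 1)) (leader η α β (dlrcCum η α β ν (T + 1)))
        + dist1 (dlrcPlay η α β ν T) (leader η α β (dlrcCum η α β ν (T + 1))) := by
      rw [dist1_comm (dlrcPlay η α β ν T)]
      exact dist1_triangle _ _ _
    rw [sum_range_succ, ← hD]
    set a := dist1 (dlrcPlay η α β ν (T + 1)) (leader η α β (dlrcCum η α β ν (T + 1)))
    set b := dist1 (dlrcPlay η α β ν T) (leader η α β (dlrcCum η α β ν (T + 1)))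
    -- The `1 / 10` term kept in the induction hypothesis meets the new `15 / 100` term at the same
    -- leader; together they control the movement between consecutive plays.
    have hab : 6 / 100 * D ^ 2 ≤ 15 / 100 * a ^ 2 + 1 / 10 * b ^ 2 := by
      have : D ^ 2 ≤ (a + b) ^ 2 := by gcongr
      nlinarith [sq_nonneg (3 * a - 2 * b)]
    have hNN : 0 ≤ η ^ 2 * N ^ 2 := by positivity
    linarith [sq_nonneg D]

/-- The regret of DLRC-OMWU, and zero, are bounded by the utility variation (RVU bound). -/
theorem rvu_bound {T : ℕ} (hT : 1 ≤ T) {B : ℝ}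
    (hB : B = 5 / 2 + (alphaOf d β * Real.log T + Real.log d) / η
        + ∑ t ∈ range (T - 1), (6 * η * ‖ν (t + 1) - ν t‖ ^ 2
          - 1 / (24 * η) * dist1 (dlrcPlay η (alphaOf d β) β ν (t + 1))
            (dlrcPlay η (alphaOf d β) β ν t) ^ 2)) :
    0 ≤ B ∧ ∀ k, ∑ t ∈ range T, (ν t k - ν t ⬝ᵥ dlrcPlay η (alphaOf d β) β ν t) ≤ B := by
  obtain ⟨T, rfl⟩ : ∃ S, T = S + 1 := ⟨T - 1, by omega⟩
  rw [Nat.add_sub_cancel] at hB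
  have hα := hp.one_le_alpha
  have hη50 := hp.le
  have h := potential_le hη hη1 hβ hp hν T
  set α := alphaOf d β with hα'
  have hTpos : (0 : ℝ) < ((T + 1 : ℕ) : ℝ) := by positivity
  have hlogT : 0 ≤ Real.log ((T + 1 : ℕ) : ℝ) := Real.log_natCast_nonneg _
  have hlogd : 0 ≤ Real.log (d : ℝ) := Real.log_natCast_nonneg _
  have r1 := learningRate_isRate hη hη1 hβ hp (dlrcCum η α β ν (T + 1))
  have r0 := learningRate_isRate hη hη1 hβ hp (0 : Fin d → ℝ)
  have h0 : potential η α β (0 : Fin d → ℝ) ≤ Real.log d + (α - 1) * Real.log η := by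
    unfold potential
    rw [rateObjective_eq, lse_zero_left]
    have := Real.log_le_log r0.pos r0.le
    have := mul_le_mul_of_nonneg_left this (by linarith : 0 ≤ α - 1)
    linarith
  have hge : ∀ l, 0 < l → l ≤ η → ∀ k,
      l * dlrcCum η α β ν (T + 1) k + (α - 1) * Real.log l
        ≤ potential η α β (dlrcCum η α β ν (T + 1)) := fun l hl hle k => by
    have h1 := r1.max l hl hle
    rw [rateObjective_eq α _ l] at h1
    have := mul_le_lse (dlrcCum η α β ν (T + 1)) l k
    unfold potential
    linarith
  have hsum : ∑ t ∈ range T, (6 * η ^ 2 * ‖ν (t + 1) - ν t‖ ^ 2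
          - 1 / 24 * dist1 (dlrcPlay η α β ν (t + 1)) (dlrcPlay η α β ν t) ^ 2)
      = η * ∑ t ∈ range T, (6 * η * ‖ν (t + 1) - ν t‖ ^ 2
          - 1 / (24 * η) * dist1 (dlrcPlay η α β ν (t + 1)) (dlrcPlay η α β ν t) ^ 2) := by
    rw [mul_sum]
    refine sum_congr rfl fun t _ => ?_
    field_simp
  rw [hsum] at h
  set S := ∑ t ∈ range T, (6 * η * ‖ν (t + 1) - ν t‖ ^ 2
          - 1 / (24 * η) * dist1 (dlrcPlay η α β ν (t + 1)) (dlrcPlay η α β ν t) ^ 2)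
  have hsq := sq_nonneg (dist1 (dlrcPlay η α β ν T)
    (leader η α β (dlrcCum η α β ν (T + 1))))
  have hB' : η * B = 5 / 2 * η + (α * Real.log ((T + 1 : ℕ) : ℝ) + Real.log d) + η * S := by
    rw [hB]
    field_simp
  have hαT : (α - 1) * Real.log ((T + 1 : ℕ) : ℝ) ≤ α * Real.log ((T + 1 : ℕ) : ℝ) :=
    mul_le_mul_of_nonneg_right (by linarith) hlogT
  have hηη : 6 * η ^ 2 ≤ 1 / 2 * η := by nlinarith
  constructor
  · refine nonneg_of_mul_nonneg_right (a := η) ?_ hη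
    -- The competitor with rate `η / T`, `T` being the number of rounds: corrected utilities are at
    -- least `-2`, so it loses at most `2 * η` besides the `log T` cost. This and `6 * η² ≤ η / 2`
    -- give the `5 / 2`.
    have h1 := hge (η / ((T + 1 : ℕ) : ℝ)) (by positivity)
      (div_le_self hη.le (by exact_mod_cast hT)) 0
    rw [Real.log_div hη.ne' hTpos.ne'] at h1
    have h2 : -(2 * ((T + 1 : ℕ) : ℝ)) ≤ dlrcCum η α β ν (T + 1) 0 := by
      rw [dlrcCum_apply]
      have := sum_le_sum fun t (_ : t ∈ range (T + 1)) =>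
        (abs_le.1 (abs_dlrcCorr_le η α β hν t 0)).1
      simp only [sum_const, card_range, nsmul_eq_mul] at this
      refine le_trans (le_of_eq ?_) this
      ring
    have h3 := mul_le_mul_of_nonneg_left h2 (by positivity : 0 ≤ η / ((T + 1 : ℕ) : ℝ))
    have h4 : η / ((T + 1 : ℕ) : ℝ) * -(2 * ((T + 1 : ℕ) : ℝ)) = -(2 * η) := by
      field_simp
    linarith
  · intro k
    rw [← dlrcCum_apply]
    refine le_of_mul_le_mul_left ?_ hη
    have h1 := hge η hη le_rfl k
    have : 0 ≤ α * Real.log ((T + 1 : ℕ) : ℝ) := mul_nonneg (by linarith) hlogT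
    linarith

end Dynamics

/-! ### Reduction of regret to pure actions. -/

section Regret

variable {d : ℕ} [NeZero d]

theorem regret_le {ν x : ℕ → Fin d → ℝ} {T : ℕ} {B : ℝ}
    (h : ∀ k, ∑ t ∈ range T, (ν t k - ν t ⬝ᵥ x t) ≤ B) : regret ν x T ≤ B := by
  unfold regret
  have : Nonempty (stdSimplex ℝ (Fin d)) := ⟨⟨_, single_mem_stdSimplex ℝ 0⟩⟩
  rw [sub_le_iff_le_add]
  refine ciSup_le fun y => ?_
  have hk : ∀ k, ∑ t ∈ range T, ν t k ≤ B + ∑ t ∈ range T, ν t ⬝ᵥ x t := fun k => by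
    have := h k
    rw [sum_sub_distrib] at this
    linarith
  calc ∑ t ∈ range T, ν t ⬝ᵥ (y : Fin d → ℝ)
      = ∑ k, (∑ t ∈ range T, ν t k) * (y : Fin d → ℝ) k := by
        simp only [dotProduct, sum_mul]
        exact sum_comm
    _ ≤ ∑ k, (B + ∑ t ∈ range T, ν t ⬝ᵥ x t) * (y : Fin d → ℝ) k :=
        sum_le_sum fun k _ => mul_le_mul_of_nonneg_right (hk k) (y.2.1 k)
    _ = B + ∑ t ∈ range T, ν t ⬝ᵥ x t := by
        have hy : ∑ k, (y : Fin d → ℝ) k = 1 := y.2.2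
        rw [← mul_sum]
        exact (congrArg _ hy).trans (mul_one _)

omit [NeZero d] in
theorem sum_sub_dotProduct_le_two_mul {ν x : ℕ → Fin d → ℝ} (hν : ∀ t k, |ν t k| ≤ 1)
    (hx : ∀ t, x t ∈ stdSimplex ℝ (Fin d)) (T : ℕ) (k : Fin d) :
    ∑ t ∈ range T, (ν t k - ν t ⬝ᵥ x t) ≤ 2 * T := by
  refine (sum_le_sum (g := fun _ => (2 : ℝ)) fun t _ => ?_).trans (by simp [mul_comm])
  linarith [(abs_le.1 (hν t k)).2, (abs_le.1 (abs_dotProduct_le (hx t) (hν t))).1]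

end Regret

/-! ### Anytime regret of multiplicative weights. -/

section MWU

variable {d : ℕ} [NeZero d]

theorem sum_softmax_mul_exp_le (lam : ℝ) (R : Fin d → ℝ) {v : Fin d → ℝ} (hv : ∀ k, |v k| ≤ 1)
    {h : ℝ} (hh : 0 ≤ h) :
    ∑ k, softmax lam R k * Real.exp (h * v k)
      ≤ Real.exp (h * (v ⬝ᵥ softmax lam R) + 2 * h ^ 2) := by
  set x := softmax lam R with hxd
  have hx : ∀ k, 0 ≤ x k := fun k => (softmax_pos lam R k).le
  have hs : ∑ k, x k = 1 := sum_softmax lam R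
  rcases le_total h 1 with h1 | h1
  · have hz : ∀ k, Real.exp (h * v k) ≤ 1 + h * v k + h ^ 2 := fun k => by
      have hvk := hv k
      have ha : |h * v k| ≤ h := by
        rw [abs_mul, abs_of_nonneg hh]
        exact mul_le_of_le_one_right hh hvk
      have h2 := (abs_le.1 (Real.abs_exp_sub_one_sub_id_le (ha.trans h1))).2
      have h3 : (h * v k) ^ 2 ≤ h ^ 2 := sq_le_sq' (by linarith [(abs_le.1 ha).1]) (abs_le.1 ha).2
      linarith
    calc ∑ k, x k * Real.exp (h * v k) ≤ ∑ k, x k * (1 + h * v k + h ^ 2) :=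
          sum_le_sum fun k _ => mul_le_mul_of_nonneg_left (hz k) (hx k)
      _ = h * (v ⬝ᵥ x) + h ^ 2 + 1 := by
          have : ∀ k, x k * (1 + h * v k + h ^ 2) = x k * (1 + h ^ 2) + h * (v k * x k) :=
            fun k => by ring
          simp only [this, sum_add_distrib, ← sum_mul, ← mul_sum, hs, dotProduct]
          ring
      _ ≤ Real.exp (h * (v ⬝ᵥ x) + h ^ 2) := Real.add_one_le_exp _
      _ ≤ _ := Real.exp_le_exp.2 (by nlinarith [sq_nonneg h])
  -- The rate of MWU can exceed `1` in early rounds; then `h ≤ -h + 2 * h ^ 2` suffices.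
  · have hvx := (abs_le.1 (abs_dotProduct_le (softmax_mem lam R) hv)).1
    calc ∑ k, x k * Real.exp (h * v k) ≤ ∑ k, x k * Real.exp h := by
          refine sum_le_sum fun k _ => mul_le_mul_of_nonneg_left (Real.exp_le_exp.2 ?_) (hx k)
          exact mul_le_of_le_one_right hh (abs_le.1 (hv k)).2
      _ = Real.exp h := by rw [← sum_mul, hs, one_mul]
      _ ≤ _ := Real.exp_le_exp.2 (by nlinarith)

theorem lse_add_le (R : Fin d → ℝ) {v : Fin d → ℝ} (hv : ∀ k, |v k| ≤ 1) {h : ℝ} (hh : 0 ≤ h) :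
    lse (R + v) h ≤ lse R h + (h * (v ⬝ᵥ softmax h R) + 2 * h ^ 2) := by
  have e : partitionFn (R + v) h
      = partitionFn R h * ∑ k, softmax h R k * Real.exp (h * v k) := by
    rw [mul_sum, partitionFn]
    refine sum_congr rfl fun k _ => ?_
    rw [softmax_eq, ← mul_assoc, mul_div_cancel₀ _ (partitionFn_pos R h).ne', ← Real.exp_add,
      ← mul_add, Pi.add_apply]
  have hp : 0 < ∑ k, softmax h R k * Real.exp (h * v k) :=
    sum_pos (fun k _ => mul_pos (softmax_pos h R k) (Real.exp_pos _)) univ_nonempty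
  rw [lse, e, Real.log_mul (partitionFn_pos R h).ne' hp.ne', lse]
  have := Real.log_le_log hp (sum_softmax_mul_exp_le h R hv hh)
  rw [Real.log_exp] at this
  linarith

/-- Power-mean monotonicity, from the Gibbs variational principle. It lets the decreasing rate of
MWU change between rounds for free. -/
theorem lse_sub_div_mono (R : Fin d → ℝ) {h h' : ℝ} (hh' : 0 < h') (hle : h' ≤ h) :
    (lse R h' - Real.log d) / h' ≤ (lse R h - Real.log d) / h := by
  have hh : 0 < h := hh'.trans_le hle
  have e1 := sum_softmax_mul_log h' R
  have e2 := relEntropy_softmax_nonneg h' h R R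
  rw [relEntropy_softmax _ (softmax_pos h' R) (sum_softmax h' R)] at e2
  have e3 := neg_log_le_sum_softmax_mul_log h' R
  set E := ∑ k, softmax h' R k * Real.log (softmax h' R k)
  calc (lse R h' - Real.log d) / h' = R ⬝ᵥ softmax h' R - (E + Real.log d) / h' := by
        rw [e1]
        field_simp
        ring
    _ ≤ R ⬝ᵥ softmax h' R - (E + Real.log d) / h := by
        have := div_le_div_of_nonneg_left (by linarith : 0 ≤ E + Real.log d) hh' hle
        linarith
    _ = (h * (R ⬝ᵥ softmax h' R) - (E + Real.log d)) / h := by field_simp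
    _ ≤ _ := by
        refine div_le_div_of_nonneg_right ?_ hh.le
        linarith

/-- The learning rate of MWU after `s` rounds. -/
noncomputable def mwuRate (d s : ℕ) : ℝ := √(Real.log d / (s + 1))

omit [NeZero d] in
theorem mwu_stateAgainst (ν : ℕ → Fin d → ℝ) (t : ℕ) :
    (mwu d).stateAgainst ν t = ⟨∑ s ∈ range t, ν s, t⟩ := by
  induction t with
  | zero => rfl
  | succ t ih =>
    rw [OnlineAlgorithm.stateAgainst, ih, sum_range_succ]
    rfl

omit [NeZero d] in
theorem mwu_playAgainst (ν : ℕ → Fin d → ℝ) (t : ℕ) :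
    (mwu d).playAgainst ν t = softmax (mwuRate d t) (∑ s ∈ range t, ν s) := by
  rw [OnlineAlgorithm.playAgainst, mwu_stateAgainst]
  rfl

theorem sum_mwuRate_le (d T : ℕ) : ∑ s ∈ range T, mwuRate d s ≤ 2 * √(T * Real.log d) := by
  induction T with
  | zero => simp
  | succ T ih =>
    rw [sum_range_succ]
    have hl : 0 ≤ Real.log (d : ℝ) := Real.log_natCast_nonneg d
    have hT : (0 : ℝ) < (T : ℝ) + 1 := by positivity
    have ha := Real.sqrt_pos.2 hT
    have h1 : mwuRate d T = √(Real.log d) * (1 / √((T : ℝ) + 1)) := by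
      rw [mwuRate, Real.sqrt_div hl]
      ring
    rw [Real.sqrt_mul (by positivity)] at ih ⊢
    push_cast
    have h2 : 1 / √((T : ℝ) + 1) ≤ 2 * √((T : ℝ) + 1) - 2 * √(T : ℝ) := by
      rw [div_le_iff₀ ha]
      nlinarith [Real.sq_sqrt hT.le, Real.sq_sqrt (Nat.cast_nonneg (α := ℝ) T),
        sq_nonneg (√((T : ℝ) + 1) - √(T : ℝ))]
    have h3 := mul_le_mul_of_nonneg_left h2 (Real.sqrt_nonneg (Real.log d))
    rw [← h1] at h3
    linarith

/-- Anytime regret bound of MWU. -/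
theorem mwu_regret_le (hd : 2 ≤ d) {ν : ℕ → Fin d → ℝ} (hν : ∀ t k, |ν t k| ≤ 1) (T : ℕ)
    (k : Fin d) :
    ∑ t ∈ range T, (ν t k - ν t ⬝ᵥ (mwu d).playAgainst ν t) ≤ 6 * √(T * Real.log d) := by
  have hl : 0 < Real.log (d : ℝ) := by linarith [log_two_le_log hd]
  have hpos : ∀ s, 0 < mwuRate d s := fun s => Real.sqrt_pos.2 (by positivity)
  have key : ∀ T, (lse (∑ s ∈ range T, ν s) (mwuRate d T) - Real.log d) / mwuRate d T
      ≤ ∑ t ∈ range T, ν t ⬝ᵥ (mwu d).playAgainst ν t + 2 * ∑ s ∈ range T, mwuRate d s := by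
    intro T
    induction T with
    | zero => simp [lse_zero_left]
    | succ T ih =>
      have hle : mwuRate d (T + 1) ≤ mwuRate d T := by
        refine Real.sqrt_le_sqrt (div_le_div_of_nonneg_left hl.le (by positivity) ?_)
        push_cast
        linarith
      refine (lse_sub_div_mono _ (hpos (T + 1)) hle).trans ?_
      rw [sum_range_succ, sum_range_succ, sum_range_succ, mwu_playAgainst]
      have h1 := lse_add_le (∑ s ∈ range T, ν s) (hν T) (hpos T).le
      rw [div_le_iff₀ (hpos T)] at ih ⊢
      linarith
  rcases Nat.eq_zero_or_pos T with rfl | hT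
  · simp
  have hT' : (1 : ℝ) ≤ T := by exact_mod_cast hT
  have h1 := key T
  have h2 := mul_le_lse (∑ s ∈ range T, ν s) (mwuRate d T) k
  have h3 := sum_mwuRate_le d T
  have h4 : Real.log d / mwuRate d T ≤ 2 * √(T * Real.log d) := by
    rw [div_le_iff₀ (hpos T), mul_assoc, mwuRate, ← Real.sqrt_mul (by positivity)]
    have : (Real.log d / 2) ^ 2 ≤ T * Real.log d * (Real.log d / (T + 1)) := by
      rw [mul_div_assoc', le_div_iff₀ (by positivity)]
      nlinarith [sq_nonneg (Real.log (d : ℝ))]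
    have := Real.le_sqrt_of_sq_le this
    linarith
  rw [sub_div] at h1
  have h5 : (∑ s ∈ range T, ν s) k ≤ lse (∑ s ∈ range T, ν s) (mwuRate d T) / mwuRate d T := by
    rw [le_div_iff₀ (hpos T)]
    linarith
  rw [Finset.sum_apply] at h5
  rw [sum_sub_distrib]
  linarith

end MWU

/-! ### Runs of the safeguarded algorithm before and after the switch. -/

section Safeguard

variable {n d : ℕ} {L β : ℝ}

/-- The utility variation over the first `t` rounds. -/
noncomputable def variation (ν : ℕ → Fin d → ℝ) (t : ℕ) : ℝ :=
  ∑ τ ∈ range (t - 1), ‖ν (τ + 1) - ν τ‖ ^ 2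

/-- The monitor memory after `t` rounds without a switch. -/
noncomputable def monitorAfter (ν : ℕ → Fin d → ℝ) (b : DLRCState d) (t : ℕ) : MonitorState d :=
  ⟨b, t, if t = 0 then 0 else ν (t - 1), variation ν t⟩

theorem safeguarded_observe (ν : ℕ → Fin d → ℝ) (b : DLRCState d) (t : ℕ) :
    (variation ν (t + 1) ≤ checkThreshold n d L β (t + 1) →
      (safeguarded n d L β).observe (Sum.inl (monitorAfter ν b t)) (ν t)
        = Sum.inl (monitorAfter ν
          ((dlrcOMWU d (etaOf n L) (alphaOf d β) β).observe b (ν t)) (t + 1))) ∧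
    (checkThreshold n d L β (t + 1) < variation ν (t + 1) →
      (safeguarded n d L β).observe (Sum.inl (monitorAfter ν b t)) (ν t)
        = Sum.inr (mwu d).init) := by
  have hvar : (if t = 0 then 0 else variation ν t + ‖ν t - (if t = 0 then 0 else ν (t - 1))‖ ^ 2)
      = variation ν (t + 1) := by
    cases t with
    | zero => simp [variation]
    | succ t => simp [variation, sum_range_succ]
  constructor
  · intro h
    simp only [safeguarded, monitorAfter]
    rw [hvar, if_neg (not_lt.2 h)]
    simp
  · intro h
    simp only [safeguarded, monitorAfter]
    rw [hvar, if_pos h]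
    rfl

theorem safeguarded_init (ν : ℕ → Fin d → ℝ) :
    (safeguarded n d L β).init
      = Sum.inl (monitorAfter ν (dlrcOMWU d (etaOf n L) (alphaOf d β) β).init 0) := by
  simp [safeguarded, monitorAfter, variation]

theorem safeguarded_stateAgainst (ν : ℕ → Fin d → ℝ) (t : ℕ)
    (h : ∀ s, 1 ≤ s → s ≤ t → variation ν s ≤ checkThreshold n d L β s) :
    (safeguarded n d L β).stateAgainst ν t
      = Sum.inl (monitorAfter ν
          ((dlrcOMWU d (etaOf n L) (alphaOf d β) β).stateAgainst ν t) t) := by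
  induction t with
  | zero => exact safeguarded_init ν
  | succ t ih =>
    rw [OnlineAlgorithm.stateAgainst, ih fun s h1 h2 => h s h1 (by omega)]
    exact (safeguarded_observe ν _ t).1 (h (t + 1) (by omega) le_rfl)

theorem safeguarded_stateAgainst_switch (ν : ℕ → Fin d → ℝ) (t : ℕ)
    (h : ∀ s, 1 ≤ s → s ≤ t → variation ν s ≤ checkThreshold n d L β s)
    (hv : checkThreshold n d L β (t + 1) < variation ν (t + 1)) (s : ℕ) :
    (safeguarded n d L β).stateAgainst ν (t + 1 + s)
      = Sum.inr ((mwu d).stateAgainst (fun s => ν (t + 1 + s)) s) := by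
  induction s with
  | zero =>
    change (safeguarded n d L β).observe ((safeguarded n d L β).stateAgainst ν t) (ν t) = _
    rw [safeguarded_stateAgainst ν t h]
    exact (safeguarded_observe ν _ t).2 hv
  | succ s ih =>
    rw [← add_assoc, OnlineAlgorithm.stateAgainst, ih]
    rfl

theorem safeguarded_playAgainst (ν : ℕ → Fin d → ℝ) (t : ℕ)
    (h : ∀ s, 1 ≤ s → s ≤ t → variation ν s ≤ checkThreshold n d L β s) :
    (safeguarded n d L β).playAgainst ν t = dlrcPlay (etaOf n L) (alphaOf d β) β ν t := by
  rw [OnlineAlgorithm.playAgainst, safeguarded_stateAgainst ν t h]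
  rfl

theorem safeguarded_playAgainst_switch (ν : ℕ → Fin d → ℝ) (t : ℕ)
    (h : ∀ s, 1 ≤ s → s ≤ t → variation ν s ≤ checkThreshold n d L β s)
    (hv : checkThreshold n d L β (t + 1) < variation ν (t + 1)) (s : ℕ) :
    (safeguarded n d L β).playAgainst ν (t + 1 + s)
      = (mwu d).playAgainst (fun s => ν (t + 1 + s)) s := by
  rw [OnlineAlgorithm.playAgainst, safeguarded_stateAgainst_switch ν t h hv]
  rfl

theorem safeguarded_playAgainst_mem [NeZero d] (ν : ℕ → Fin d → ℝ) (t : ℕ) :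
    (safeguarded n d L β).playAgainst ν t ∈ stdSimplex ℝ (Fin d) := by
  rw [OnlineAlgorithm.playAgainst]
  cases (safeguarded n d L β).stateAgainst ν t with
  | inl s => exact softmax_mem _ _
  | inr m => exact softmax_mem _ _

end Safeguard

/-! ### Explicit constants and adversarial regret. -/

section Bounds

variable {n d : ℕ} {L β : ℝ}

theorem sq_mul_eq : (12 * √2 * L * n) ^ 2 = 288 * L ^ 2 * n ^ 2 := by
  have : √(2 : ℝ) ^ 2 = 2 := Real.sq_sqrt (by norm_num)
  linear_combination 144 * L ^ 2 * n ^ 2 * this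

theorem etaOf_mul_le (hn : 1 ≤ n) (hL : 0 < L) : etaOf n L * (12 * √2 * L * n) ≤ 1 := by
  have hn' : (0 : ℝ) < n := by exact_mod_cast hn
  have ha : 0 < 12 * √2 * L * n := by positivity
  exact (le_div_iff₀ ha).1 (min_le_right _ _)

theorem inv_etaOf (hn : 1 ≤ n) (hL : 0 < L) :
    1 / etaOf n L + 12 * √2 * L * n = max (50 + 12 * √2 * L * n) (24 * √2 * L * n) := by
  have hn' : (0 : ℝ) < n := by exact_mod_cast hn
  have ha : 0 < 12 * √2 * L * n := by positivity
  set a := 12 * √2 * L * n with had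
  have e : 24 * √2 * L * n = a + a := by rw [had]; ring
  rw [e, max_add_add_right]
  congr 1
  unfold etaOf
  rw [← had]
  rcases le_total 50 a with h | h
  · rw [min_eq_right (one_div_le_one_div_of_le (by norm_num) h), max_eq_right h, one_div_one_div]
  · rw [min_eq_left (one_div_le_one_div_of_le ha h), max_eq_left h, one_div_one_div]

/-- The horizon-dependent factor `α log T + log d`. -/
noncomputable def logFactor (d : ℕ) (β : ℝ) (T : ℕ) : ℝ :=
  alphaOf d β * Real.log T + Real.log d

theorem alphaOf_nonneg (hβ : 70 ≤ β) : 0 ≤ alphaOf d β := by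
  have : 0 ≤ Real.log (d : ℝ) := Real.log_natCast_nonneg d
  unfold alphaOf
  positivity

theorem logFactor_nonneg (hβ : 70 ≤ β) (T : ℕ) : 0 ≤ logFactor d β T :=
  add_nonneg (mul_nonneg (alphaOf_nonneg hβ) (Real.log_natCast_nonneg T))
    (Real.log_natCast_nonneg d)

theorem logFactor_mono (hβ : 70 ≤ β) {S T : ℕ} (hS : 1 ≤ S) (h : S ≤ T) :
    logFactor d β S ≤ logFactor d β T := by
  have : Real.log S ≤ Real.log T :=
    Real.log_le_log (by exact_mod_cast hS) (by exact_mod_cast h)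
  have := mul_le_mul_of_nonneg_left this (alphaOf_nonneg (d := d) hβ)
  unfold logFactor
  linarith

theorem checkThreshold_eq (T : ℕ) : checkThreshold n d L β T
    = 144 * L ^ 2 * n ^ 2 * etaOf n L + 48 * L ^ 2 * n ^ 2 * logFactor d β T := rfl

theorem checkThreshold_mono (hβ : 70 ≤ β) {S T : ℕ} (hS : 1 ≤ S) (h : S ≤ T) :
    checkThreshold n d L β S ≤ checkThreshold n d L β T := by
  rw [checkThreshold_eq, checkThreshold_eq]
  have := mul_le_mul_of_nonneg_left (logFactor_mono (d := d) hβ hS h)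
    (by positivity : 0 ≤ 48 * L ^ 2 * (n : ℝ) ^ 2)
  linarith

theorem regretBound_eq (hn : 1 ≤ n) (hL : 0 < L) (T : ℕ) : regretBound n d L β T
    = 6 + (1 / etaOf n L + 12 * √2 * L * n) * logFactor d β T := by
  rw [inv_etaOf hn hL]
  rfl

theorem regretBound_mono (hn : 1 ≤ n) (hL : 0 < L) (hβ : 70 ≤ β) {S T : ℕ} (hS : 1 ≤ S)
    (h : S ≤ T) : regretBound n d L β S ≤ regretBound n d L β T := by
  rw [regretBound_eq hn hL, regretBound_eq hn hL]
  have := etaOf_pos hn hL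
  have := mul_le_mul_of_nonneg_left (logFactor_mono (d := d) hβ hS h)
    (by positivity : 0 ≤ 1 / etaOf n L + 12 * √2 * L * n)
  linarith

/-- The slack `4` allows for the last round before a switch, whose variation can overshoot the
threshold. -/
theorem dlrc_regret_le_of_variation [NeZero d] (hn : 1 ≤ n) (hd : 2 ≤ d) (hL : 0 < L)
    (hβ : 70 ≤ β) {ν : ℕ → Fin d → ℝ} (hν : ∀ t k, |ν t k| ≤ 1) {T : ℕ} (hT : 1 ≤ T)
    (hvar : variation ν T ≤ checkThreshold n d L β T + 4) (k : Fin d) :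
    ∑ t ∈ range T, (ν t k - ν t ⬝ᵥ dlrcPlay (etaOf n L) (alphaOf d β) β ν t)
      ≤ regretBound n d L β T := by
  have hη := etaOf_pos hn hL
  have hp := goodParams hn hd hL hβ
  have hη50 := hp.le
  refine ((rvu_bound hη (by linarith) hβ hp hν hT rfl).2 k).trans ?_
  have hs : ∑ t ∈ range (T - 1), (6 * etaOf n L * ‖ν (t + 1) - ν t‖ ^ 2
          - 1 / (24 * etaOf n L) * dist1 (dlrcPlay (etaOf n L) (alphaOf d β) β ν (t + 1))
            (dlrcPlay (etaOf n L) (alphaOf d β) β ν t) ^ 2)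
      ≤ 6 * etaOf n L * variation ν T := by
    rw [variation, mul_sum]
    refine sum_le_sum fun t _ => ?_
    have : 0 ≤ 1 / (24 * etaOf n L) * dist1 (dlrcPlay (etaOf n L) (alphaOf d β) β ν (t + 1))
            (dlrcPlay (etaOf n L) (alphaOf d β) β ν t) ^ 2 := by positivity
    linarith
  rw [regretBound_eq hn hL]
  rw [checkThreshold_eq] at hvar
  have hM := logFactor_nonneg (d := d) hβ T
  change 5 / 2 + logFactor d β T / etaOf n L + _ ≤ _
  have ha := etaOf_mul_le hn hL
  have hn' : (0 : ℝ) < n := by exact_mod_cast hn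
  have ha0 : 0 < 12 * √2 * L * n := by positivity
  have hsq := sq_mul_eq (L := L) (n := n)
  set a := 12 * √2 * L * n
  set η := etaOf n L
  set M := logFactor d β T
  -- In terms of `a`, the threshold coefficients are `a² / 2` and `a² / 6`. With `η * a ≤ 1` the
  -- constants sum to at most `5 / 2 + 3 + 24 / 50 < 6`.
  have e1 : 6 * η * variation ν T ≤ 6 * η * (1 / 2 * a ^ 2 * η + 1 / 6 * a ^ 2 * M + 4) := by
    refine mul_le_mul_of_nonneg_left ?_ (by positivity)
    rw [hsq]
    linarith
  have e2 : (η * a) * (η * a) ≤ 1 := by nlinarith [mul_pos hη ha0]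
  have e3 : (η * a) * (a * M) ≤ 1 * (a * M) := mul_le_mul_of_nonneg_right ha (by positivity)
  have e4 : (1 / η + a) * M = M / η + a * M := by ring
  rw [e4]
  linarith

theorem safeguarded_regret_le [NeZero d] (hn : 1 ≤ n) (hd : 2 ≤ d) (hL : 0 < L)
    (hβ : 70 ≤ β) {ν : ℕ → Fin d → ℝ} (hν : ∀ t k, |ν t k| ≤ 1) {T : ℕ} (hT : 1 ≤ T)
    (k : Fin d) :
    ∑ t ∈ range T, (ν t k - ν t ⬝ᵥ (safeguarded n d L β).playAgainst ν t)
      ≤ regretBound n d L β T + 6 * √(T * Real.log d) := by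
  -- Accepted checks up to `t` mean that round `t + 1` is still played by DLRC-OMWU, whatever its
  -- own check says; that round adds at most `2² = 4` to the variation.
  have before : ∀ t, (∀ s, 1 ≤ s → s ≤ t → variation ν s ≤ checkThreshold n d L β s) →
      ∑ τ ∈ range (t + 1), (ν τ k - ν τ ⬝ᵥ (safeguarded n d L β).playAgainst ν τ)
        ≤ regretBound n d L β (t + 1) := fun t h => by
    have e : ∀ τ ∈ range (t + 1), ν τ k - ν τ ⬝ᵥ (safeguarded n d L β).playAgainst ν τ
        = ν τ k - ν τ ⬝ᵥ dlrcPlay (etaOf n L) (alphaOf d β) β ν τ := fun τ hτ => by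
      rw [safeguarded_playAgainst ν τ fun s h1 h2 => h s h1 (by have := mem_range.1 hτ; omega)]
    rw [sum_congr rfl e]
    refine dlrc_regret_le_of_variation hn hd hL hβ hν (by omega) ?_ k
    cases t with
    | zero =>
      have h0 := logFactor_nonneg (d := d) hβ (0 + 1)
      have h1 := etaOf_pos hn hL
      have : 0 ≤ checkThreshold n d L β (0 + 1) := by
        rw [checkThreshold_eq]
        positivity
      simp only [variation]
      simp only [zero_add, tsub_self, range_zero, sum_empty] at this ⊢
      linarith
    | succ t =>
      have h1 := h (t + 1) (by omega) le_rfl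
      have h2 : variation ν (t + 1 + 1) = variation ν (t + 1) + ‖ν (t + 1) - ν t‖ ^ 2 := by
        simp [variation, sum_range_succ]
      have h3 : ‖ν (t + 1) - ν t‖ ≤ 2 := by
        refine (pi_norm_le_iff_of_nonneg (by norm_num)).2 fun k => ?_
        have a1 := abs_le.1 (hν (t + 1) k)
        have a2 := abs_le.1 (hν t k)
        rw [Pi.sub_apply, Real.norm_eq_abs, abs_le]
        constructor <;> linarith
      have h4 := checkThreshold_mono (n := n) (d := d) (L := L) hβ (by omega : 1 ≤ t + 1)
        (Nat.le_succ (t + 1))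
      have h5 := norm_nonneg (ν (t + 1) - ν t)
      rw [h2]
      simp only [Nat.succ_eq_add_one] at h4
      nlinarith
  by_cases hacc : ∀ s, 1 ≤ s → s ≤ T - 1 → variation ν s ≤ checkThreshold n d L β s
  · have := before (T - 1) hacc
    rw [Nat.sub_add_cancel hT] at this
    have := Real.sqrt_nonneg (T * Real.log d)
    linarith
  · push Not at hacc
    have hex : ∃ s, 1 ≤ s ∧ checkThreshold n d L β s < variation ν s := by
      obtain ⟨s, h1, -, h2⟩ := hacc
      exact ⟨s, h1, h2⟩
    classical
    obtain ⟨s, h1, hsT, h2⟩ := hacc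
    -- The switch happens at the first failing check.
    obtain ⟨hf1, hf2⟩ := Nat.find_spec hex
    have hmin : ∀ s < Nat.find hex, 1 ≤ s → variation ν s ≤ checkThreshold n d L β s :=
      fun s hs h1 => not_lt.1 fun h => Nat.find_min hex hs ⟨h1, h⟩
    have hfs : Nat.find hex ≤ s := Nat.find_min' hex ⟨h1, h2⟩
    obtain ⟨t, ht⟩ : ∃ t, Nat.find hex = t + 1 := ⟨Nat.find hex - 1, by omega⟩
    rw [ht] at hf2 hmin hfs
    obtain ⟨r, rfl⟩ : ∃ r, T = t + 1 + r := ⟨T - (t + 1), by omega⟩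
    have hpre : ∀ s, 1 ≤ s → s ≤ t → variation ν s ≤ checkThreshold n d L β s :=
      fun s h1 h2 => hmin s (by omega) h1
    rw [sum_range_add]
    have A := before t hpre
    have B := mwu_regret_le hd (ν := fun s => ν (t + 1 + s)) (fun s k => hν _ k) r k
    have e : ∀ τ ∈ range r, ν (t + 1 + τ) k
        - ν (t + 1 + τ) ⬝ᵥ (safeguarded n d L β).playAgainst ν (t + 1 + τ)
        = ν (t + 1 + τ) k
          - ν (t + 1 + τ) ⬝ᵥ (mwu d).playAgainst (fun s => ν (t + 1 + s)) τ := fun τ _ => by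
      rw [safeguarded_playAgainst_switch ν t hpre hf2]
    rw [sum_congr rfl e]
    have C := regretBound_mono (d := d) hn hL hβ (by omega : 1 ≤ t + 1)
      (Nat.le_add_right (t + 1) r)
    have D : √(r * Real.log d) ≤ √((t + 1 + r : ℕ) * Real.log d) := by
      refine Real.sqrt_le_sqrt (mul_le_mul_of_nonneg_right ?_ (Real.log_natCast_nonneg d))
      exact_mod_cast Nat.le_add_left _ _
    linarith

theorem logFactor_le (hd : 2 ≤ d) (hβ : 70 ≤ β) {T : ℕ} (hT : 2 ≤ T) :
    logFactor d β T ≤ 2 * β * (Real.log d ^ 2 * Real.log T) := by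
  have hl := log_two_le_log hd
  have ht := log_two_le_log hT
  unfold logFactor alphaOf
  set l := Real.log (d : ℝ)
  set t := Real.log (T : ℝ)
  have h1 : 2 + 2 * l ≤ 8 * l ^ 2 := by nlinarith
  have h2 : l ≤ 4 * l ^ 2 * t := by
    have : l ≤ 2 * l ^ 2 := by nlinarith
    nlinarith [sq_nonneg l]
  have h3 := mul_le_mul_of_nonneg_right h1 (by linarith : 0 ≤ t)
  have h4 : 70 * (l ^ 2 * t) ≤ β * (l ^ 2 * t) := mul_le_mul_of_nonneg_right hβ (by positivity)
  have h5 : 0 ≤ l ^ 2 * t := by positivity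
  linarith

theorem regretBound_le (hd : 2 ≤ d) (hL : 0 < L) (hβ : 70 ≤ β) {T : ℕ}
    (hT : 2 ≤ T) :
    regretBound n d L β T ≤ 101 * (β * (1 + L * n) * (Real.log d ^ 2 * Real.log T)) := by
  have hl := log_two_le_log hd
  have ht := log_two_le_log hT
  have hM := logFactor_le hd hβ hT
  have hM0 := logFactor_nonneg (d := d) hβ T
  have hLn : 0 ≤ L * n := by positivity
  have hsq : √(2 : ℝ) ≤ 2 := Real.sqrt_le_sqrt (by norm_num : (2 : ℝ) ≤ 4) |>.trans
    (le_of_eq (by rw [show (4 : ℝ) = 2 ^ 2 by norm_num, Real.sqrt_sq (by norm_num)]))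
  have hsL := mul_le_mul_of_nonneg_right hsq hLn
  have hmax : max (50 + 12 * √2 * L * n) (24 * √2 * L * n) ≤ 50 * (1 + L * n) :=
    max_le (by linarith) (by linarith)
  change 6 + _ * logFactor d β T ≤ _
  have h1 := mul_le_mul_of_nonneg_right hmax hM0
  have h2 := mul_le_mul_of_nonneg_left hM (by positivity : 0 ≤ 50 * (1 + L * n))
  set P := Real.log d ^ 2 * Real.log T
  have hP : 3 / 10 ≤ P := by
    have : 48 / 100 ≤ Real.log (d : ℝ) ^ 2 := by nlinarith
    nlinarith
  have h3 : 6 ≤ β * (1 + L * n) * P := by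
    have : 70 ≤ β * (1 + L * n) := by nlinarith
    nlinarith
  linarith

theorem safeguarded_regret_le_sqrt [NeZero d] (hn : 1 ≤ n) (hd : 2 ≤ d) (hL : 0 < L)
    (hβ : 70 ≤ β) {ν : ℕ → Fin d → ℝ} (hν : ∀ t k, |ν t k| ≤ 1) {T : ℕ} (hT : 2 ≤ T)
    (k : Fin d) :
    ∑ t ∈ range T, (ν t k - ν t ⬝ᵥ (safeguarded n d L β).playAgainst ν t)
      ≤ 21 * √(β * (1 + L * n)) * √(Real.log d * Real.log T) * √(T * Real.log d) := by
  have A := safeguarded_regret_le hn hd hL hβ hν (by omega : 1 ≤ T) k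
  have B := sum_sub_dotProduct_le_two_mul hν (fun t => safeguarded_playAgainst_mem
    (n := n) (L := L) (β := β) ν t) T k
  have C := regretBound_le (n := n) hd hL hβ hT
  have hl := log_two_le_log hd
  have ht := log_two_le_log hT
  set reg := ∑ t ∈ range T, (ν t k - ν t ⬝ᵥ (safeguarded n d L β).playAgainst ν t)
  set b := regretBound n d L β T
  have hb : 0 ≤ b := by
    have := etaOf_pos hn hL
    have := logFactor_nonneg (d := d) hβ T
    change 0 ≤ regretBound n d L β T
    rw [regretBound_eq hn hL]
    positivity
  have hT0 : (0 : ℝ) ≤ T := Nat.cast_nonneg T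
  have hβL : 70 ≤ β * (1 + L * n) := by
    have : 0 ≤ L * n := by positivity
    nlinarith
  have hlt : 48 / 100 ≤ Real.log d * Real.log T := by nlinarith
  set X := √(β * (1 + L * n)) * √(Real.log d * Real.log T) * √(T * Real.log d) with hX
  have hX0 : 0 ≤ X := by positivity
  have hX2 : X ^ 2 = β * (1 + L * n) * (Real.log d * Real.log T) * (T * Real.log d) := by
    rw [hX, mul_pow, mul_pow, Real.sq_sqrt (by linarith), Real.sq_sqrt (by linarith),
      Real.sq_sqrt (by positivity)]
  have hY : √(T * Real.log d) ≤ X := by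
    have h1 : 1 ≤ √(β * (1 + L * n)) * √(Real.log d * Real.log T) := by
      rw [← Real.sqrt_mul (by linarith), Real.one_le_sqrt]
      nlinarith
    have := mul_le_mul_of_nonneg_right h1 (Real.sqrt_nonneg (T * Real.log d))
    linarith
  have hbT : b * (2 * T) ≤ (15 * X) ^ 2 := by
    have := mul_le_mul_of_nonneg_right C (by positivity : (0 : ℝ) ≤ 2 * T)
    have h0 := sq_nonneg X
    rw [mul_pow]
    rw [hX2] at h0 ⊢
    linarith
  -- The minimum of the logarithmic bound and the trivial bound `2 * T` is at most their geometric
  -- mean, and `202 ≤ 15²`.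
  have hmin : min b (2 * T) ≤ 15 * X := by
    have hmin0 : 0 ≤ min b (2 * (T : ℝ)) := le_min hb (by positivity)
    refine (pow_le_pow_iff_left₀ hmin0 (by positivity) two_ne_zero).1 (le_trans ?_ hbT)
    rw [sq]
    exact mul_le_mul (min_le_left _ _) (min_le_right _ _) (le_min hb (by positivity)) hb
  have hreg : reg ≤ 21 * X := by
    rcases min_choice b (2 * (T : ℝ)) with h | h <;> rw [h] at hmin <;> linarith
  refine hreg.trans (le_of_eq ?_)
  rw [hX]
  ring

end Bounds

/-! ### Self-play: variation, the silent safeguard, individual regret. -/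

section SelfPlay

variable {n d : ℕ} {L β : ℝ}

theorem Game.abs_expectedUtility_le {G : Game n d} (hG : G.Bounded) (i : Fin n)
    {x : Fin n → Fin d → ℝ} (hx : ∀ j, x j ∈ stdSimplex ℝ (Fin d)) :
    |G.expectedUtility i x| ≤ 1 := by
  have h1 : ∑ s : Fin n → Fin d, ∏ j, x j (s j) = 1 := by
    rw [← Fintype.prod_sum]
    exact prod_eq_one fun j _ => (hx j).2
  unfold Game.expectedUtility
  refine (abs_sum_le_sum_abs _ _).trans (le_trans (sum_le_sum fun s _ => ?_) h1.le)
  have h0 : 0 ≤ ∏ j, x j (s j) := prod_nonneg fun j _ => (hx j).1 _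
  rw [abs_mul, abs_of_nonneg h0]
  exact mul_le_of_le_one_right h0 (hG i s)

theorem Game.abs_utilityVector_le {G : Game n d} (hG : G.Bounded) (i : Fin n)
    {x : Fin n → Fin d → ℝ} (hx : ∀ j, x j ∈ stdSimplex ℝ (Fin d)) (k : Fin d) :
    |G.utilityVector i x k| ≤ 1 := by
  refine abs_expectedUtility_le hG i fun j => ?_
  by_cases h : j = i
  · subst h
    rw [Function.update_self]
    exact single_mem_stdSimplex ℝ k
  · rw [Function.update_of_ne h]
    exact hx j

/-- The utility vectors that player `i` observes in self-play. -/
noncomputable def selfPlayUtility (A : OnlineAlgorithm d) (G : Game n d) (i : Fin n) (t : ℕ) :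
    Fin d → ℝ :=
  G.utilityVector i (A.selfPlay G t)

/-- Reduces self-play to play against the sequence that self-play itself generates, so the RVU bound
applies. -/
theorem selfPlayState_eq (A : OnlineAlgorithm d) (G : Game n d) (i : Fin n) (t : ℕ) :
    A.selfPlayState G t i = A.stateAgainst (selfPlayUtility A G i) t := by
  induction t with
  | zero => rfl
  | succ t ih =>
    rw [OnlineAlgorithm.stateAgainst, ← ih]
    rfl

theorem selfPlay_eq (A : OnlineAlgorithm d) (G : Game n d) (i : Fin n) (t : ℕ) :
    A.selfPlay G t i = A.playAgainst (selfPlayUtility A G i) t := by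
  rw [OnlineAlgorithm.selfPlay, selfPlayState_eq, OnlineAlgorithm.playAgainst]

variable [NeZero d]

theorem dlrc_selfPlay_mem (η α : ℝ) (G : Game n d) (t : ℕ) (i : Fin n) :
    (dlrcOMWU d η α β).selfPlay G t i ∈ stdSimplex ℝ (Fin d) := softmax_mem _ _

theorem abs_dlrc_selfPlayUtility_le (η α : ℝ) {G : Game n d} (hG : G.Bounded) (i : Fin n) (t : ℕ)
    (k : Fin d) : |selfPlayUtility (dlrcOMWU d η α β) G i t k| ≤ 1 :=
  Game.abs_utilityVector_le hG i (dlrc_selfPlay_mem η α G t) k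

/-- In self-play of DLRC-OMWU the utility variation of every player passes every check. -/
theorem dlrc_variation_le (hn : 1 ≤ n) (hd : 2 ≤ d) (hL : 0 < L) (hβ : 70 ≤ β) {G : Game n d}
    (hG : G.Bounded) (hS : G.Smooth L) (i : Fin n) {T : ℕ} (hT : 1 ≤ T) :
    variation (selfPlayUtility (dlrcOMWU d (etaOf n L) (alphaOf d β) β) G i) T
      ≤ checkThreshold n d L β T := by
  have hη := etaOf_pos hn hL
  have hp := goodParams hn hd hL hβ
  have hη50 := hp.le
  have hn' : (0 : ℝ) < n := by exact_mod_cast hn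
  set A := dlrcOMWU d (etaOf n L) (alphaOf d β) β with hA
  set D : Fin n → ℕ → ℝ := fun j t =>
    dist1 (A.selfPlay G (t + 1) j) (A.selfPlay G t j) ^ 2 with hD
  set E := ∑ t ∈ range (T - 1), ∑ j, D j t with hE
  have hvar : ∀ i, variation (selfPlayUtility A G i) T ≤ L ^ 2 * n * E := fun i => by
    rw [variation, hE, mul_sum]
    refine sum_le_sum fun t _ => ?_
    have h1 := hS i _ _ (dlrc_selfPlay_mem (β := β) (etaOf n L) (alphaOf d β) G (t + 1))
      (dlrc_selfPlay_mem (β := β) (etaOf n L) (alphaOf d β) G t)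
    have h2 := sq_sum_le_card_mul_sum_sq (s := (univ : Finset (Fin n)))
      (f := fun j => dist1 (A.selfPlay G (t + 1) j) (A.selfPlay G t j))
    rw [card_univ, Fintype.card_fin] at h2
    calc ‖selfPlayUtility A G i (t + 1) - selfPlayUtility A G i t‖ ^ 2
        ≤ (L * ∑ j, dist1 (A.selfPlay G (t + 1) j) (A.selfPlay G t j)) ^ 2 :=
          pow_le_pow_left₀ (norm_nonneg _) h1 2
      _ = L ^ 2 * (∑ j, dist1 (A.selfPlay G (t + 1) j) (A.selfPlay G t j)) ^ 2 := by ring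
      _ ≤ L ^ 2 * (n * ∑ j, D j t) := mul_le_mul_of_nonneg_left h2 (sq_nonneg L)
      _ = _ := by ring
  have hrvu : ∀ i, 0 ≤ 5 / 2 + logFactor d β T / etaOf n L
      + (6 * etaOf n L * variation (selfPlayUtility A G i) T
        - 1 / (24 * etaOf n L) * ∑ t ∈ range (T - 1), D i t) := fun i => by
    have h := (rvu_bound hη (by linarith) hβ hp
      (abs_dlrc_selfPlayUtility_le (β := β) (etaOf n L) (alphaOf d β) hG i) hT rfl).1
    rw [sum_sub_distrib, ← mul_sum, ← mul_sum] at h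
    simp only [hD, selfPlay_eq]
    exact h
  -- The nonnegative sides of the RVU bounds are used here, not the regrets, which may be negative.
  have hsum := sum_nonneg fun i (_ : i ∈ (univ : Finset (Fin n))) => hrvu i
  have hswap : ∑ i, ∑ t ∈ range (T - 1), D i t = E := sum_comm
  rw [sum_add_distrib, sum_const, card_univ, Fintype.card_fin, nsmul_eq_mul, sum_sub_distrib,
    ← mul_sum, ← mul_sum, hswap] at hsum
  have hV : ∑ i, variation (selfPlayUtility A G i) T ≤ n * (L ^ 2 * n * E) := by
    refine (sum_le_sum fun i _ => hvar i).trans ?_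
    simp
  have hE0 : 0 ≤ E := sum_nonneg fun _ _ => sum_nonneg fun _ _ => sq_nonneg _
  have hM := logFactor_nonneg (d := d) hβ T
  have ha := etaOf_mul_le hn hL
  have ha0 : 0 < 12 * √2 * L * n := by positivity
  have hsq := sq_mul_eq (L := L) (n := n)
  refine (hvar i).trans ?_
  rw [checkThreshold_eq]
  set a := 12 * √2 * L * n
  set η := etaOf n L
  set M := logFactor d β T
  -- Multiplying by `48 * η` turns the variation term into `(η * a)² * E ≤ E` against `-2 * E`, so
  -- half of the negative term survives.
  have hEle : E ≤ 120 * n * η + 48 * n * M := by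
    have h1 := mul_le_mul_of_nonneg_left hV (by positivity : 0 ≤ 6 * η)
    have h2 : 0 ≤ n * (5 / 2 + M / η) + (6 * η * (n * (L ^ 2 * n * E)) - 1 / (24 * η) * E) := by
      linarith
    have h3 := mul_nonneg h2 (by positivity : 0 ≤ 48 * η)
    have h4 : (n * (5 / 2 + M / η) + (6 * η * (n * (L ^ 2 * n * E)) - 1 / (24 * η) * E)) * (48 * η)
        = 120 * n * η + 48 * n * M + (η * η * (288 * L ^ 2 * n ^ 2)) * E - 2 * E := by
      field_simp
      ring
    rw [h4, ← hsq] at h3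
    have h5 : η * η * a ^ 2 ≤ 1 := by nlinarith [mul_pos hη ha0]
    have h6 := mul_le_mul_of_nonneg_right h5 hE0
    linarith
  have h7 := mul_le_mul_of_nonneg_left hEle (by positivity : 0 ≤ L ^ 2 * n)
  have h8 : 0 ≤ L ^ 2 * n ^ 2 * η := by positivity
  linarith

/-- A switch by one player would change what all the others observe, so the induction treats all
players at once: while nobody has switched, the utilities are those of DLRC-OMWU, whose variation
passes the next check. -/
theorem safeguarded_selfPlayState (hn : 1 ≤ n) (hd : 2 ≤ d) (hL : 0 < L) (hβ : 70 ≤ β)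
    {G : Game n d} (hG : G.Bounded) (hS : G.Smooth L) (t : ℕ) (i : Fin n) :
    (safeguarded n d L β).selfPlayState G t i
      = Sum.inl (monitorAfter
          (selfPlayUtility (dlrcOMWU d (etaOf n L) (alphaOf d β) β) G i)
          ((dlrcOMWU d (etaOf n L) (alphaOf d β) β).selfPlayState G t i) t) := by
  induction t generalizing i with
  | zero => exact safeguarded_init _
  | succ t ih =>
    have e : (fun j => (safeguarded n d L β).play ((safeguarded n d L β).selfPlayState G t j))
        = (dlrcOMWU d (etaOf n L) (alphaOf d β) β).selfPlay G t := by
      funext j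
      rw [ih j]
      rfl
    change (safeguarded n d L β).observe ((safeguarded n d L β).selfPlayState G t i)
      (G.utilityVector i fun j => (safeguarded n d L β).play
        ((safeguarded n d L β).selfPlayState G t j)) = _
    rw [e, ih i]
    exact (safeguarded_observe _ _ t).1 (dlrc_variation_le hn hd hL hβ hG hS i (by omega))

theorem safeguarded_selfPlay (hn : 1 ≤ n) (hd : 2 ≤ d) (hL : 0 < L) (hβ : 70 ≤ β)
    {G : Game n d} (hG : G.Bounded) (hS : G.Smooth L) (t : ℕ) :
    (safeguarded n d L β).selfPlay G t
      = (dlrcOMWU d (etaOf n L) (alphaOf d β) β).selfPlay G t := by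
  funext i
  rw [OnlineAlgorithm.selfPlay, safeguarded_selfPlayState hn hd hL hβ hG hS]
  rfl

theorem dlrc_selfPlayRegret_le (hn : 1 ≤ n) (hd : 2 ≤ d) (hL : 0 < L) (hβ : 70 ≤ β)
    {G : Game n d} (hG : G.Bounded) (hS : G.Smooth L) (i : Fin n) {T : ℕ} (hT : 1 ≤ T) :
    (dlrcOMWU d (etaOf n L) (alphaOf d β) β).selfPlayRegret G i T ≤ regretBound n d L β T := by
  refine regret_le fun k => ?_
  simp only [selfPlay_eq]
  exact dlrc_regret_le_of_variation hn hd hL hβ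
    (abs_dlrc_selfPlayUtility_le (etaOf n L) (alphaOf d β) hG i) hT
    ((dlrc_variation_le hn hd hL hβ hG hS i hT).trans (by linarith)) k

end SelfPlay

end DLRC

theorem theorem5p3 :
    ∃ C : ℝ, ∀ (n d : ℕ) (L β : ℝ), 1 ≤ n → 2 ≤ d → 0 < L → 70 ≤ β →
      -- self-play, in every bounded `L`-smooth game
      (∀ G : DLRC.Game n d, G.Bounded → G.Smooth L →
        -- every player's regret under DLRC-OMWU, for all horizons at once
        (∀ (i : Fin n) (T : ℕ), 1 ≤ T →
          (DLRC.dlrcOMWU d (DLRC.etaOf n L) (DLRC.alphaOf d β) β).selfPlayRegret G i T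
              ≤ DLRC.regretBound n d L β T ∧
          (2 ≤ T →
            (DLRC.dlrcOMWU d (DLRC.etaOf n L) (DLRC.alphaOf d β) β).selfPlayRegret G i T
              ≤ C * β * (1 + L) * (n * Real.log d ^ 2 * Real.log T))) ∧
        -- the safeguarded variant plays exactly the same strategies in self-play
        (∀ t : ℕ, (DLRC.safeguarded n d L β).selfPlay G t
            = (DLRC.dlrcOMWU d (DLRC.etaOf n L) (DLRC.alphaOf d β) β).selfPlay G t)) ∧
      -- the safeguarded variant against arbitrary utilities, for all horizons at once
      (∀ ν : ℕ → Fin d → ℝ, (∀ t k, |ν t k| ≤ 1) → ∀ T : ℕ, 1 ≤ T →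
        (DLRC.safeguarded n d L β).regretAgainst ν T
            ≤ DLRC.regretBound n d L β T + C * Real.sqrt (T * Real.log d) ∧
        (2 ≤ T →
          (DLRC.safeguarded n d L β).regretAgainst ν T
            ≤ C * Real.sqrt (β * (1 + L * n)) * Real.sqrt (Real.log d * Real.log T)
                * Real.sqrt (T * Real.log d))) := by
  -- `101` comes from `regretBound_le`; the other two bounds need only `6` and `21`.
  refine ⟨101, fun n d L β hn hd hL hβ => ?_⟩
  have : NeZero d := ⟨by omega⟩
  refine ⟨fun G hG hS => ⟨fun i T hT => ?_, DLRC.safeguarded_selfPlay hn hd hL hβ hG hS⟩,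
    fun ν hν T hT => ?_⟩
  · have h := DLRC.dlrc_selfPlayRegret_le hn hd hL hβ hG hS i hT
    refine ⟨h, fun hT2 => (h.trans (DLRC.regretBound_le hd hL hβ hT2)).trans ?_⟩
    have hP : 0 ≤ Real.log d ^ 2 * Real.log T :=
      mul_nonneg (sq_nonneg _) (Real.log_natCast_nonneg T)
    have hn1 : (1 : ℝ) ≤ n := by exact_mod_cast hn
    have h1 : β * (1 + L * n) ≤ β * ((1 + L) * n) :=
      mul_le_mul_of_nonneg_left (by linarith) (by linarith)
    have h2 := mul_le_mul_of_nonneg_right h1 hP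
    linarith
  · refine ⟨DLRC.regret_le fun k =>
      (DLRC.safeguarded_regret_le hn hd hL hβ hν hT k).trans ?_, fun hT2 => DLRC.regret_le fun k =>
      (DLRC.safeguarded_regret_le_sqrt hn hd hL hβ hν hT2 k).trans ?_⟩
    · have := Real.sqrt_nonneg (T * Real.log d)
      linarith
    · gcongr
      norm_num
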